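/- Let $n\ge 1$ be a natural number and let $E^1_n$ denote the class of (lightface) $\Pi^1_n$ subsets of $\omega$ if $n$ is odd, and of (lightface) $\Sigma^1_n$ subsets of $\omega$ if $n$ is even. A numbering of a family $\mathcal S\subseteq P(\omega)$ is a surjective map $\nu:\omega\to\mathcal S$; it is $E^1_n$-computable if the set $\{\langle k,x\rangle : x\in\nu(k)\}$ belongs to $E^1_n$, where $\langle\cdot,\cdot\rangle$ is a standard pairing function, and $\mathcal S$ is $E^1_n$-computable if it has an $E^1_n$-computable numbering. For numberings $\nu,\mu$ write $\nu\le\mu$ if there is a total computable function $f$ with $\nu(k)=\mu(f(k))$ for all $k$, and $\nu\equiv\mu$ if $\nu\le\mu$ and $\mu\le\nu$. The Rogers semilattice $\mathcal R^1_n(\mathcal S)$ is the upper semilattice of all $\equiv$-classes of $E^1_n$-computable numberings of $\mathcal S$, ordered by $\le$; the supremum of the classes of $\nu$ and $\mu$ is the class of $\nu\oplus\mu$, where $(\nu\oplus\mu)(2x)=\nu(x)$ and $(\nu\oplus\mu)(2x+1)=\mu(x)$. Let $\mathcal S$ be an arbitrary (finite or infinite) $E^1_n$-computable family that contains at least two elements.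 Then $\mathcal R^1_n(\mathcal S)$ is infinite, and it is not a lattice (that is, some two of its elements have no greatest lower bound). -/

import Mathlib

/-- Programs with an oracle for a total function `ℕ → ℕ` (the oracle versions of the programs for
partial recursive functions `Nat.Partrec`). A program plays the role of the index `e` in `φ_e^g`. -/
inductive OracleCode : Type
  | zero : OracleCode
  | succ : OracleCode
  | left : OracleCode
  | right : OracleCode
  | oracle : OracleCode
  | pair : OracleCode → OracleCode → OracleCode
  | comp : OracleCode → OracleCode → OracleCode
  | prec : OracleCode → OracleCode → OracleCode
  | rfind : OracleCode → OracleCode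

/-- `c.eval g` is the partial function `φ_c^g` computed by the program `c` with oracle `g`. -/
def OracleCode.eval (g : ℕ → ℕ) : OracleCode → ℕ → Part ℕ
  | .zero => fun _ => Part.some 0
  | .succ => fun n => Part.some (n + 1)
  | .left => fun n => Part.some (Nat.unpair n).1
  | .right => fun n => Part.some (Nat.unpair n).2
  | .oracle => fun n => Part.some (g n)
  | .pair c d => fun n =>
      (c.eval g n).bind fun a => (d.eval g n).map fun b => Nat.pair a b
  | .comp c d => fun n => (d.eval g n).bind (c.eval g)
  | .prec c d => fun p =>
      (Nat.unpair p).2.rec (c.eval g (Nat.unpair p).1) fun y ih =>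
        ih.bind fun i => d.eval g (Nat.pair (Nat.unpair p).1 (Nat.pair y i))
  | .rfind c => fun a => Nat.rfind fun n =>
      (c.eval g (Nat.pair a n)).map fun m => decide (m = 0)

/-- The join of two sequences: `(ν ⊕ μ) (2x) = ν x` and `(ν ⊕ μ) (2x + 1) = μ x`. -/
def seqJoin {α : Type} (ν μ : ℕ → α) (k : ℕ) : α :=
  if k % 2 = 0 then ν (k / 2) else μ (k / 2)

/-- The join `f₁ ⊕ ⋯ ⊕ fₙ` of `n` functions: its value at `n * z + i` is `f i z` for `i < n`
(for `n = 0`, it is constantly `0`). -/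
def oracleJoin {n : ℕ} (f : Fin n → ℕ → ℕ) (k : ℕ) : ℕ :=
  if h : k % n < n then f ⟨k % n, h⟩ (k / n) else 0

/-- The program `c` witnesses that `R(x, y; f₁, …, fₙ)` is a recursive predicate: for all arguments
it halts, and the predicate holds if and only if the output is `1`. -/
def WitnessesRecursive {n : ℕ} (c : OracleCode) (R : ℕ → ℕ → (Fin n → ℕ → ℕ) → Prop) : Prop :=
  ∀ (f : Fin n → ℕ → ℕ) (x y : ℕ),
    (c.eval (oracleJoin f) (Nat.pair x y)).Dom ∧
      (R x y f ↔ 1 ∈ c.eval (oracleJoin f) (Nat.pair x y))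

/-- `R(x, y; f₁, …, fₙ)` is a recursive predicate. -/
def IsRecursivePred {n : ℕ} (R : ℕ → ℕ → (Fin n → ℕ → ℕ) → Prop) : Prop :=
  ∃ c : OracleCode, WitnessesRecursive c R

/-- Alternating quantifiers `(Q₁ f₁) (Q₂ f₂) … (Qₙ fₙ) (Qₙ₊₁ y)` in front of `P`, with `n` quantifiers
over functions followed by one over numbers. The first quantifier is `∀` if the Boolean is `true`
and `∃` if it is `false`. -/
def altQuant : (univ : Bool) → (n : ℕ) → (P : (Fin n → ℕ → ℕ) → ℕ → Prop) → Prop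
  | true, 0, P => ∀ y, P Fin.elim0 y
  | false, 0, P => ∃ y, P Fin.elim0 y
  | true, n + 1, P => ∀ f : ℕ → ℕ, altQuant false n fun F => P (Fin.cons f F)
  | false, n + 1, P => ∃ f : ℕ → ℕ, altQuant true n fun F => P (Fin.cons f F)

/-- For `n ≥ 1`: `X ⊆ ω` is a `Π¹ₙ` set (lightface), by the normal form
`(∀ f₁) (∃ f₂) … (Q fₙ) (Q̄ y) R(x, y; f₁, …, fₙ)` with `R` recursive. -/
def IsPi1 (n : ℕ) (X : Set ℕ) : Prop :=
  ∃ R : ℕ → ℕ → (Fin n → ℕ → ℕ) → Prop,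
    IsRecursivePred R ∧ ∀ x, x ∈ X ↔ altQuant true n fun f y => R x y f

/-- For `n ≥ 1`: `X ⊆ ω` is a `Σ¹ₙ` set (lightface), by the normal form
`(∃ f₁) (∀ f₂) … (Q fₙ) (Q̄ y) R(x, y; f₁, …, fₙ)` with `R` recursive. -/
def IsSigma1 (n : ℕ) (X : Set ℕ) : Prop :=
  ∃ R : ℕ → ℕ → (Fin n → ℕ → ℕ) → Prop,
    IsRecursivePred R ∧ ∀ x, x ∈ X ↔ altQuant false n fun f y => R x y f

/-- The class `E¹ₙ`: it is `Π¹ₙ` for odd `n`, and `Σ¹ₙ` for even `n`. -/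
def IsE1 (n : ℕ) (X : Set ℕ) : Prop :=
  (Odd n → IsPi1 n X) ∧ (Even n → IsSigma1 n X)

/-- `G_ν = {⟨k, x⟩ : x ∈ ν k}`. -/
def numberingGraph (ν : ℕ → Set ℕ) : Set ℕ :=
  {p | (Nat.unpair p).2 ∈ ν (Nat.unpair p).1}

/-- `ν` is a numbering of the family `S`. -/
def IsNumbering (ν : ℕ → Set ℕ) (S : Set (Set ℕ)) : Prop :=
  Set.range ν = S

/-- The numbering `ν` is `E¹ₙ`-computable. -/
def IsE1ComputableNumbering (n : ℕ) (ν : ℕ → Set ℕ) : Prop :=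
  IsE1 n (numberingGraph ν)

/-- The family `S` is `E¹ₙ`-computable: it has an `E¹ₙ`-computable numbering. -/
def IsE1ComputableFamily (n : ℕ) (S : Set (Set ℕ)) : Prop :=
  ∃ ν : ℕ → Set ℕ, IsNumbering ν S ∧ IsE1ComputableNumbering n ν

/-- Reducibility of numberings by a total computable function. -/
def NumberingReducible (ν μ : ℕ → Set ℕ) : Prop :=
  ∃ f : ℕ → ℕ, Computable f ∧ ∀ k, ν k = μ (f k)

/-- The set of all `E¹ₙ`-computable numberings of the family `S`. -/
def E1Com (n : ℕ) (S : Set (Set ℕ)) : Type :=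
  {ν : ℕ → Set ℕ // IsNumbering ν S ∧ IsE1ComputableNumbering n ν}

instance (n : ℕ) (S : Set (Set ℕ)) : Preorder (E1Com n S) where
  le ν μ := NumberingReducible ν.1 μ.1
  le_refl _ := ⟨id, Computable.id, fun _ => rfl⟩
  le_trans _ _ _ := fun ⟨f, hf, h⟩ ⟨g, hg, h'⟩ =>
    ⟨fun k => g (f k), hg.comp hf, fun k => (h k).trans (h' (f k))⟩

theorem OracleCode.exists_of_partrec {f : ℕ →. ℕ} (hf : Nat.Partrec f) :
    ∃ c : OracleCode, ∀ g, c.eval g = f := by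
  induction hf with
  | zero => exact ⟨.zero, fun g => rfl⟩
  | succ => exact ⟨.succ, fun g => rfl⟩
  | left => exact ⟨.left, fun g => rfl⟩
  | right => exact ⟨.right, fun g => rfl⟩
  | pair _ _ h1 h2 =>
    obtain ⟨c, hc⟩ := h1
    obtain ⟨d, hd⟩ := h2
    exact ⟨.pair c d, fun g => by
      funext n
      simp only [OracleCode.eval, hc, hd]
      simp [Seq.seq, Part.bind_map]⟩
  | comp _ _ h1 h2 =>
    obtain ⟨c, hc⟩ := h1
    obtain ⟨d, hd⟩ := h2
    exact ⟨.comp c d, fun g => by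
      funext n
      simp only [OracleCode.eval, hc, hd]
      rfl⟩
  | prec _ _ h1 h2 =>
    obtain ⟨c, hc⟩ := h1
    obtain ⟨d, hd⟩ := h2
    exact ⟨.prec c d, fun g => by
      funext p
      simp only [OracleCode.eval, hc, hd]
      rfl⟩
  | rfind _ h1 =>
    obtain ⟨c, hc⟩ := h1
    exact ⟨.rfind c, fun g => by
      funext a
      simp only [OracleCode.eval, hc]
      rfl⟩

theorem OracleCode.exists_of_computable {f : ℕ → ℕ} (hf : Computable f) :
    ∃ c : OracleCode, ∀ g k, c.eval g k = Part.some (f k) := by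
  obtain ⟨c, hc⟩ := OracleCode.exists_of_partrec (Partrec.nat_iff.1 hf)
  exact ⟨c, fun g k => by rw [hc]; rfl⟩

/-- Definition by cases along a computable function, at the level of recursive predicates. -/
theorem IsRecursivePred.cases {n : ℕ} {R₀ R₁ : ℕ → ℕ → (Fin n → ℕ → ℕ) → Prop}
    (h₀ : IsRecursivePred R₀) (h₁ : IsRecursivePred R₁) {s g : ℕ → ℕ}
    (hs : Computable s) (hg : Computable g) :
    IsRecursivePred fun x y f => if s x = 0 then R₀ (g x) y f else R₁ (g x) y f := by
  obtain ⟨c₀, h₀⟩ := h₀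
  obtain ⟨c₁, h₁⟩ := h₁
  obtain ⟨d, hd⟩ := OracleCode.exists_of_computable
    (f := fun p => Nat.pair (g p.unpair.1) p.unpair.2)
    (Primrec₂.natPair.to_comp.comp (hg.comp (Computable.fst.comp Computable.unpair))
      (Computable.snd.comp Computable.unpair))
  obtain ⟨e, he⟩ := OracleCode.exists_of_computable (f := fun p => s p.unpair.1)
    (hs.comp (Computable.fst.comp Computable.unpair))
  obtain ⟨q, hq⟩ := OracleCode.exists_of_computable
    (f := fun p => if p.unpair.1 = 0 then p.unpair.2.unpair.1 else p.unpair.2.unpair.2)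
    (Primrec.ite (Primrec.eq.comp (Primrec.fst.comp Primrec.unpair) (Primrec.const 0))
      (Primrec.fst.comp (Primrec.unpair.comp (Primrec.snd.comp Primrec.unpair)))
      (Primrec.snd.comp (Primrec.unpair.comp (Primrec.snd.comp Primrec.unpair)))).to_comp
  refine ⟨.comp q (.pair e (.pair (.comp c₀ d) (.comp c₁ d))), fun f x y => ?_⟩
  obtain ⟨hd₀, hr₀⟩ := h₀ f (g x) y
  obtain ⟨hd₁, hr₁⟩ := h₁ f (g x) y
  obtain ⟨v₀, hv₀⟩ := Part.dom_iff_mem.1 hd₀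
  obtain ⟨v₁, hv₁⟩ := Part.dom_iff_mem.1 hd₁
  rw [Part.eq_some_iff.2 hv₀] at hr₀
  rw [Part.eq_some_iff.2 hv₁] at hr₁
  have key : (OracleCode.comp q (.pair e (.pair (.comp c₀ d) (.comp c₁ d)))).eval
      (oracleJoin f) (Nat.pair x y) = Part.some (if s x = 0 then v₀ else v₁) := by
    simp [OracleCode.eval, he, hd, hq, Part.eq_some_iff.2 hv₀, Part.eq_some_iff.2 hv₁]
  rw [key]
  refine ⟨trivial, ?_⟩
  by_cases h : s x = 0
  · simpa [h] using hr₀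
  · simpa [h] using hr₁

theorem exists_altQuant_numberingGraph_seqJoin {n : ℕ} {b : Bool} {ν μ : ℕ → Set ℕ}
    (hν : ∃ R : ℕ → ℕ → (Fin n → ℕ → ℕ) → Prop, IsRecursivePred R ∧
      ∀ x, x ∈ numberingGraph ν ↔ altQuant b n fun f y => R x y f)
    (hμ : ∃ R : ℕ → ℕ → (Fin n → ℕ → ℕ) → Prop, IsRecursivePred R ∧
      ∀ x, x ∈ numberingGraph μ ↔ altQuant b n fun f y => R x y f) :
    ∃ R : ℕ → ℕ → (Fin n → ℕ → ℕ) → Prop, IsRecursivePred R ∧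
      ∀ x, x ∈ numberingGraph (seqJoin ν μ) ↔ altQuant b n fun f y => R x y f := by
  obtain ⟨R₀, h₀, hR₀⟩ := hν
  obtain ⟨R₁, h₁, hR₁⟩ := hμ
  have hs : Computable fun p : ℕ => p.unpair.1 % 2 :=
    (Primrec.nat_mod.comp (Primrec.fst.comp Primrec.unpair) (Primrec.const 2)).to_comp
  have hg : Computable fun p : ℕ => Nat.pair (p.unpair.1 / 2) p.unpair.2 :=
    (Primrec₂.natPair.comp
      (Primrec.nat_div.comp (Primrec.fst.comp Primrec.unpair) (Primrec.const 2))
      (Primrec.snd.comp Primrec.unpair)).to_comp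
  refine ⟨_, h₀.cases h₁ hs hg, fun x => ?_⟩
  by_cases h : x.unpair.1 % 2 = 0
  · simp only [h, if_true]
    rw [← hR₀]
    simp [numberingGraph, seqJoin, h]
  · simp only [h, if_false]
    rw [← hR₁]
    simp [numberingGraph, seqJoin, h]

theorem isNumbering_seqJoin {ν μ : ℕ → Set ℕ} {S : Set (Set ℕ)}
    (hν : IsNumbering ν S) (hμ : IsNumbering μ S) : IsNumbering (seqJoin ν μ) S := by
  apply Set.Subset.antisymm
  · rintro _ ⟨k, rfl⟩
    unfold seqJoin
    split_ifs
    · exact hν ▸ Set.mem_range_self _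
    · exact hμ ▸ Set.mem_range_self _
  · intro A hA
    obtain ⟨k, rfl⟩ : A ∈ Set.range ν := hν.symm ▸ hA
    exact ⟨2 * k, by simp [seqJoin]⟩

/-- The join `ν ⊕ μ` of two `E¹ₙ`-computable numberings of `S`. -/
def E1Com.join {n : ℕ} {S : Set (Set ℕ)} (ν μ : E1Com n S) : E1Com n S :=
  ⟨seqJoin ν.1 μ.1, isNumbering_seqJoin ν.2.1 μ.2.1,
    fun h => exists_altQuant_numberingGraph_seqJoin (ν.2.2.1 h) (μ.2.2.1 h),
    fun h => exists_altQuant_numberingGraph_seqJoin (ν.2.2.2 h) (μ.2.2.2 h)⟩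

theorem E1Com.le_join_left {n : ℕ} {S : Set (Set ℕ)} (ν μ : E1Com n S) : ν ≤ ν.join μ :=
  ⟨fun k => 2 * k, (Primrec.nat_mul.comp (Primrec.const 2) Primrec.id).to_comp,
    fun k => by simp [E1Com.join, seqJoin]⟩

theorem E1Com.le_join_right {n : ℕ} {S : Set (Set ℕ)} (ν μ : E1Com n S) : μ ≤ ν.join μ :=
  ⟨fun k => 2 * k + 1,
    (Primrec.succ.comp (Primrec.nat_mul.comp (Primrec.const 2) Primrec.id)).to_comp,
    fun k => by
      have : (2 * k + 1) / 2 = k := by omega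
      simp [E1Com.join, seqJoin, this]⟩

theorem E1Com.join_le {n : ℕ} {S : Set (Set ℕ)} {ν μ ξ : E1Com n S} (h₀ : ν ≤ ξ) (h₁ : μ ≤ ξ) :
    ν.join μ ≤ ξ := by
  obtain ⟨f, hf, hf'⟩ := h₀
  obtain ⟨g, hg, hg'⟩ := h₁
  have hdiv : Computable fun k : ℕ => k / 2 :=
    (Primrec.nat_div.comp Primrec.id (Primrec.const 2)).to_comp
  have hmod : Computable fun k : ℕ => decide (k % 2 = 0) :=
    (Primrec.eq.comp (Primrec.nat_mod.comp Primrec.id (Primrec.const 2))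
      (Primrec.const 0)).decide.to_comp
  refine ⟨_, Computable.cond hmod (hf.comp hdiv) (hg.comp hdiv), fun k => ?_⟩
  by_cases h : k % 2 = 0
  · simp [E1Com.join, seqJoin, h, hf']
  · simp [E1Com.join, seqJoin, h, hg']

/-- The Rogers semilattice `R¹ₙ(S)`: the `E¹ₙ`-computable numberings of `S` modulo
`ν ≡ μ ↔ ν ≤ μ ∧ μ ≤ ν`, ordered by reducibility. -/
def RogersSemilattice (n : ℕ) (S : Set (Set ℕ)) : Type :=
  Antisymmetrization (E1Com n S) (· ≤ ·)

instance (n : ℕ) (S : Set (Set ℕ)) : PartialOrder (RogersSemilattice n S) :=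
  inferInstanceAs (PartialOrder (Antisymmetrization (E1Com n S) (· ≤ ·)))

/-- The supremum of the degrees of `ν` and `μ` is the degree of `ν ⊕ μ`. -/
instance (n : ℕ) (S : Set (Set ℕ)) : SemilatticeSup (RogersSemilattice n S) where
  sup := Quotient.map₂ E1Com.join fun ν ν' h μ μ' h' =>
    ⟨E1Com.join_le (h.1.trans (E1Com.le_join_left ν' μ')) (h'.1.trans (E1Com.le_join_right ν' μ')),
      E1Com.join_le (h.2.trans (E1Com.le_join_left ν μ)) (h'.2.trans (E1Com.le_join_right ν μ))⟩
  le_sup_left a b := Quotient.inductionOn₂ a b fun ν μ => E1Com.le_join_left ν μ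
  le_sup_right a b := Quotient.inductionOn₂ a b fun ν μ => E1Com.le_join_right ν μ
  sup_le a b c := Quotient.inductionOn₃ a b c fun _ _ _ => E1Com.join_le

/-- An upper semilattice is a lattice if any two of its elements have an infimum. -/
def IsLatticeSemilattice (α : Type) [SemilatticeSup α] : Prop :=
  ∀ a b : α, ∃ c : α, IsGLB {a, b} c

/-! In the normal form of `E¹ₙ` the last function quantifier is universal, for odd and even `n`
alike. Such a class is closed under preimages by a function `h` computed uniformly from all members
of a nonempty `Π⁰₁` class `K`: the last universal function can also guess some `F`, a guess outside
`K` is refuted by a number, and a guess inside `K` yields `h` (`exists_altQuant_preimage`). Such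
functions, called implicitly computable, include every function that is the unique solution of an
implicitly computable system (`ImplicitlyComputable.of_unique`), hence unbounded search, a universal
function for the computable functions, and recursion along a rank. So `ν ∘ g` stays `E¹ₙ`-computable
even if `g` diagonalizes against all computable functions.

`exists_generic_sequence` builds such functions `g k` on the plane, column by column; put `α k = ν ∘
g k`. If `p`, `q` reduce a numbering to `α i` and `α j`, then `ν (g i (p m)) = ν (g j (q m))` for
all `m`. Either the construction sets these indices to `0` and `1` for some `m`, or for every `m`
one of `p m`, `q m` lies in the columns before some `s`.

For infinite `S`, with `ν 0 ≠ ν 1`, the first case is absurd, and the second leaves only finitely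
many indices. So no two `α i` have a common lower bound, which gives both claims.

For finite `S` take `ν` with `0` as the only index of `ν 0`, so that `bitFlip` always changes the
set. A greatest lower bound of `α 0` and `α 1` would have to reach `α 0` inside the columns before
some `s`. But column `s` gives a numbering below both that diagonalizes against all computable maps
into those columns. Infinitude follows: there is a least degree, and a finite upper semilattice with
a least element is a lattice. -/

open Encodable

/-! ### Total functionals computable with an oracle -/

/-- The functional `Φ` is computed by a program that halts for all oracles and all arguments. -/
def OracleComputable {α β : Type*} [Primcodable α] [Primcodable β] (Φ : (ℕ → ℕ) → α → β) : Prop :=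
  ∃ c : OracleCode, ∀ F a, c.eval F (encode a) = Part.some (encode (Φ F a))

/-- The program `c` with calls to the oracle replaced by calls to the program `d`. -/
def OracleCode.substOracle (d : OracleCode) (c : OracleCode) : OracleCode :=
  match c with
  | .zero => .zero
  | .succ => .succ
  | .left => .left
  | .right => .right
  | .oracle => d
  | .pair a b => .pair (substOracle d a) (substOracle d b)
  | .comp a b => .comp (substOracle d a) (substOracle d b)
  | .prec a b => .prec (substOracle d a) (substOracle d b)
  | .rfind a => .rfind (substOracle d a)

theorem OracleCode.eval_substOracle {d : OracleCode} {F G : ℕ → ℕ}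
    (h : ∀ x, d.eval F x = Part.some (G x)) (c : OracleCode) :
    (OracleCode.substOracle d c).eval F = c.eval G := by
  induction c with
  | oracle => funext x; simp [OracleCode.substOracle, OracleCode.eval, h]
  | _ => simp_all [OracleCode.substOracle, OracleCode.eval]

namespace OracleComputable

variable {α β γ : Type*} [Primcodable α] [Primcodable β] [Primcodable γ]

theorem of_computable {f : α → β} (hf : Computable f) :
    OracleComputable fun _ : ℕ → ℕ => f := by
  -- On a valid code the decoded value is wrapped in `some`, which raises its code by one; `pred`
  -- undoes this. Other inputs do not matter.
  have h : Computable fun n : ℕ => (encode ((decode n : Option α).map f)).pred :=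
    Computable.pred.comp (Computable.encode.comp
      (Computable.option_map Computable.decode (hf.comp Computable.snd).to₂))
  obtain ⟨c, hc⟩ := OracleCode.exists_of_computable h
  exact ⟨c, fun F a => by simp [hc]⟩

theorem oracle : OracleComputable fun (F : ℕ → ℕ) (x : ℕ) => F x :=
  ⟨.oracle, fun F a => by simp [OracleCode.eval]⟩

theorem comp {Φ : (ℕ → ℕ) → β → γ} {Ψ : (ℕ → ℕ) → α → β}
    (hΦ : OracleComputable Φ) (hΨ : OracleComputable Ψ) :
    OracleComputable fun F a => Φ F (Ψ F a) := by
  obtain ⟨c, hc⟩ := hΦ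
  obtain ⟨d, hd⟩ := hΨ
  exact ⟨.comp c d, fun F a => by simp [OracleCode.eval, hc, hd]⟩

theorem pair {Φ : (ℕ → ℕ) → α → β} {Ψ : (ℕ → ℕ) → α → γ}
    (hΦ : OracleComputable Φ) (hΨ : OracleComputable Ψ) :
    OracleComputable fun F a => (Φ F a, Ψ F a) := by
  obtain ⟨c, hc⟩ := hΦ
  obtain ⟨d, hd⟩ := hΨ
  exact ⟨.pair c d, fun F a => by simp [OracleCode.eval, hc, hd]⟩

theorem subst {Φ : (ℕ → ℕ) → α → β} {Ψ : (ℕ → ℕ) → ℕ → ℕ}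
    (hΦ : OracleComputable Φ) (hΨ : OracleComputable Ψ) :
    OracleComputable fun F a => Φ (Ψ F) a := by
  obtain ⟨c, hc⟩ := hΦ
  obtain ⟨d, hd⟩ := hΨ
  exact ⟨OracleCode.substOracle d c, fun F a => by
    rw [OracleCode.eval_substOracle (G := Ψ F) (fun x => by simpa using hd F x)]; exact hc _ _⟩

theorem map {f : β → γ} {Φ : (ℕ → ℕ) → α → β} (hf : Computable f) (hΦ : OracleComputable Φ) :
    OracleComputable fun F a => f (Φ F a) :=
  (of_computable hf).comp hΦ

theorem query {h : α → ℕ} (hh : Computable h) :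
    OracleComputable fun (F : ℕ → ℕ) a => F (h a) :=
  oracle.comp (of_computable hh)

end OracleComputable

/-- The restriction of `J` to the even numbers. -/
def evenPart (J : ℕ → ℕ) (x : ℕ) : ℕ := J (2 * x)

/-- The restriction of `J` to the odd numbers. -/
def oddPart (J : ℕ → ℕ) (x : ℕ) : ℕ := J (2 * x + 1)

@[simp] theorem evenPart_seqJoin (F f : ℕ → ℕ) : evenPart (seqJoin F f) = F := by
  funext x; simp [evenPart, seqJoin]

@[simp] theorem oddPart_seqJoin (F f : ℕ → ℕ) : oddPart (seqJoin F f) = f := by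
  funext x
  have : (2 * x + 1) / 2 = x := by omega
  simp [oddPart, seqJoin, this]

theorem seqJoin_evenPart_oddPart (J : ℕ → ℕ) : seqJoin (evenPart J) (oddPart J) = J := by
  funext x
  rcases Nat.mod_two_eq_zero_or_one x with h | h
  · simp only [seqJoin, h, if_true, evenPart]
    congr 1; omega
  · simp only [seqJoin, h, oddPart]
    simp only [one_ne_zero, if_false]
    congr 1; omega

theorem computable_two_mul : Computable fun x : ℕ => 2 * x :=
  (Primrec.nat_mul.comp (Primrec.const 2) Primrec.id).to_comp

theorem computable_two_mul_add_one : Computable fun x : ℕ => 2 * x + 1 :=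
  Computable.succ.comp computable_two_mul

theorem oracleComputable_evenPart : OracleComputable evenPart :=
  OracleComputable.query computable_two_mul

theorem oracleComputable_oddPart : OracleComputable oddPart :=
  OracleComputable.query computable_two_mul_add_one

theorem OracleComputable.seqJoin {Φ Ψ : (ℕ → ℕ) → ℕ → ℕ}
    (hΦ : OracleComputable Φ) (hΨ : OracleComputable Ψ) :
    OracleComputable fun F => seqJoin (Φ F) (Ψ F) := by
  have hdiv : Computable fun k : ℕ => k / 2 :=
    (Primrec.nat_div.comp Primrec.id (Primrec.const 2)).to_comp
  have hsel : Computable fun p : ℕ × ℕ × ℕ => if p.1 % 2 = 0 then p.2.1 else p.2.2 :=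
    (Primrec.ite (Primrec.eq.comp (Primrec.nat_mod.comp Primrec.fst (Primrec.const 2))
      (Primrec.const 0)) (Primrec.fst.comp Primrec.snd) (Primrec.snd.comp Primrec.snd)).to_comp
  exact OracleComputable.map hsel ((of_computable Computable.id).pair
    ((hΦ.comp (of_computable hdiv)).pair (hΨ.comp (of_computable hdiv))))

/-! ### `Π⁰₁` classes and implicit computability -/

/-- A (lightface) `Π⁰₁` class of functions. -/
def IsPi01Class (K : Set (ℕ → ℕ)) : Prop :=
  ∃ Q : (ℕ → ℕ) → ℕ → Bool, OracleComputable Q ∧ ∀ F, F ∈ K ↔ ∀ y, Q F y = true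

theorem IsPi01Class.inter {K L : Set (ℕ → ℕ)} (hK : IsPi01Class K) (hL : IsPi01Class L) :
    IsPi01Class (K ∩ L) := by
  obtain ⟨Q, hQ, hQK⟩ := hK
  obtain ⟨Q', hQ', hQL⟩ := hL
  refine ⟨fun F y => Q F y && Q' F y,
    OracleComputable.map (Primrec.and.to_comp : Computable₂ _) (hQ.pair hQ'), fun F => ?_⟩
  simp [hQK, hQL, forall_and]

theorem IsPi01Class.preimage {K : Set (ℕ → ℕ)} (hK : IsPi01Class K) {Ψ : (ℕ → ℕ) → ℕ → ℕ}
    (hΨ : OracleComputable Ψ) : IsPi01Class (Ψ ⁻¹' K) := by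
  obtain ⟨Q, hQ, hQK⟩ := hK
  exact ⟨fun F => Q (Ψ F), hQ.subst hΨ, fun F => hQK _⟩

/-- Relative to any member of `K`, the functional `Φ` is computed uniformly. -/
def ComputableFrom {α β : Type*} [Primcodable α] [Primcodable β] (K : Set (ℕ → ℕ))
    (Φ : (ℕ → ℕ) → α → β) : Prop :=
  ∃ E : (ℕ → ℕ) → α → β, OracleComputable E ∧ ∀ F ∈ K, ∀ f a, E (seqJoin F f) a = Φ f a

/-- The functional `Φ` is computed uniformly from all members of some nonempty `Π⁰₁` class. -/
def ImplicitlyComputable {α β : Type*} [Primcodable α] [Primcodable β]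
    (Φ : (ℕ → ℕ) → α → β) : Prop :=
  ∃ K, IsPi01Class K ∧ K.Nonempty ∧ ComputableFrom K Φ

theorem ComputableFrom.preimage {α β : Type*} [Primcodable α] [Primcodable β]
    {K : Set (ℕ → ℕ)} {Φ : (ℕ → ℕ) → α → β} (h : ComputableFrom K Φ)
    {Ψ : (ℕ → ℕ) → ℕ → ℕ} (hΨ : OracleComputable Ψ) : ComputableFrom (Ψ ⁻¹' K) Φ := by
  obtain ⟨E, hE, hEΦ⟩ := h
  refine ⟨fun J => E (seqJoin (Ψ (evenPart J)) (oddPart J)),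
    hE.subst ((hΨ.subst oracleComputable_evenPart).seqJoin oracleComputable_oddPart),
    fun F hF f a => ?_⟩
  simpa using hEΦ _ hF f a

theorem ComputableFrom.mono {α β : Type*} [Primcodable α] [Primcodable β]
    {K L : Set (ℕ → ℕ)} {Φ : (ℕ → ℕ) → α → β} (h : ComputableFrom K Φ) (hLK : L ⊆ K) :
    ComputableFrom L Φ := by
  obtain ⟨E, hE, hEΦ⟩ := h
  exact ⟨E, hE, fun F hF => hEΦ F (hLK hF)⟩

namespace ImplicitlyComputable

variable {α β γ : Type*} [Primcodable α] [Primcodable β] [Primcodable γ]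

theorem of_oracleComputable {Φ : (ℕ → ℕ) → α → β} (h : OracleComputable Φ) :
    ImplicitlyComputable Φ :=
  ⟨Set.univ, ⟨fun _ _ => true, OracleComputable.of_computable (Computable.const true), by simp⟩,
    Set.univ_nonempty, fun J => Φ (oddPart J), h.subst oracleComputable_oddPart, by simp⟩

theorem of_computable {f : α → β} (hf : Computable f) :
    ImplicitlyComputable fun _ : ℕ → ℕ => f :=
  of_oracleComputable (OracleComputable.of_computable hf)

theorem oracle : ImplicitlyComputable fun (F : ℕ → ℕ) (x : ℕ) => F x :=
  of_oracleComputable OracleComputable.oracle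

/-- The product of the two classes, coded by joins, serves both functionals. -/
theorem exists_common {α' β' : Type*} [Primcodable α'] [Primcodable β']
    {Φ : (ℕ → ℕ) → α → β} {Ψ : (ℕ → ℕ) → α' → β'}
    (hΦ : ImplicitlyComputable Φ) (hΨ : ImplicitlyComputable Ψ) :
    ∃ K, IsPi01Class K ∧ K.Nonempty ∧ ComputableFrom K Φ ∧ ComputableFrom K Ψ := by
  obtain ⟨K, hK, ⟨F, hF⟩, h⟩ := hΦ
  obtain ⟨L, hL, ⟨G, hG⟩, h'⟩ := hΨ
  refine ⟨evenPart ⁻¹' K ∩ oddPart ⁻¹' L,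
    (hK.preimage oracleComputable_evenPart).inter (hL.preimage oracleComputable_oddPart),
    ⟨seqJoin F G, by simpa using ⟨hF, hG⟩⟩,
    (h.preimage oracleComputable_evenPart).mono Set.inter_subset_left,
    (h'.preimage oracleComputable_oddPart).mono Set.inter_subset_right⟩

theorem comp {Φ : (ℕ → ℕ) → β → γ} {Ψ : (ℕ → ℕ) → α → β}
    (hΦ : ImplicitlyComputable Φ) (hΨ : ImplicitlyComputable Ψ) :
    ImplicitlyComputable fun F a => Φ F (Ψ F a) := by
  obtain ⟨K, hK, hne, ⟨E, hE, h⟩, E', hE', h'⟩ := exists_common hΦ hΨ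
  exact ⟨K, hK, hne, _, hE.comp hE', fun F hF f a => by rw [h' F hF, h F hF]⟩

theorem pair {Φ : (ℕ → ℕ) → α → β} {Ψ : (ℕ → ℕ) → α → γ}
    (hΦ : ImplicitlyComputable Φ) (hΨ : ImplicitlyComputable Ψ) :
    ImplicitlyComputable fun F a => (Φ F a, Ψ F a) := by
  obtain ⟨K, hK, hne, ⟨E, hE, h⟩, E', hE', h'⟩ := exists_common hΦ hΨ
  exact ⟨K, hK, hne, _, hE.pair hE', fun F hF f a => by rw [h' F hF, h F hF]⟩

theorem map {f : β → γ} {Φ : (ℕ → ℕ) → α → β} (hf : Computable f)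
    (hΦ : ImplicitlyComputable Φ) : ImplicitlyComputable fun F a => f (Φ F a) :=
  (of_computable hf).comp hΦ

theorem map₂ {δ : Type*} [Primcodable δ] {f : β → γ → δ} {Φ : (ℕ → ℕ) → α → β}
    {Ψ : (ℕ → ℕ) → α → γ} (hf : Computable₂ f) (hΦ : ImplicitlyComputable Φ)
    (hΨ : ImplicitlyComputable Ψ) : ImplicitlyComputable fun F a => f (Φ F a) (Ψ F a) :=
  map (f := fun p : β × γ => f p.1 p.2) hf (hΦ.pair hΨ)

theorem ite {p : (ℕ → ℕ) → α → Prop} [∀ F a, Decidable (p F a)] {Φ Ψ : (ℕ → ℕ) → α → β}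
    (hp : ImplicitlyComputable fun F a => decide (p F a)) (hΦ : ImplicitlyComputable Φ)
    (hΨ : ImplicitlyComputable Ψ) :
    ImplicitlyComputable fun F a => if p F a then Φ F a else Ψ F a := by
  have h : Computable fun t : Bool × β × β => cond t.1 t.2.1 t.2.2 :=
    Computable.cond Computable.fst (Computable.fst.comp Computable.snd)
      (Computable.snd.comp Computable.snd)
  have := map h (hp.pair (hΦ.pair hΨ))
  simpa [Bool.cond_decide] using this

theorem eq {Φ Ψ : (ℕ → ℕ) → α → ℕ} (hΦ : ImplicitlyComputable Φ) (hΨ : ImplicitlyComputable Ψ) :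
    ImplicitlyComputable fun F a => decide (Φ F a = Ψ F a) :=
  map₂ (f := fun a b : ℕ => decide (a = b)) (Primrec.eq (α := ℕ)).decide.to_comp hΦ hΨ

theorem le {Φ Ψ : (ℕ → ℕ) → α → ℕ} (hΦ : ImplicitlyComputable Φ) (hΨ : ImplicitlyComputable Ψ) :
    ImplicitlyComputable fun F a => decide (Φ F a ≤ Ψ F a) :=
  map₂ (f := fun a b : ℕ => decide (a ≤ b)) Primrec.nat_le.decide.to_comp hΦ hΨ

theorem lt {Φ Ψ : (ℕ → ℕ) → α → ℕ} (hΦ : ImplicitlyComputable Φ) (hΨ : ImplicitlyComputable Ψ) :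
    ImplicitlyComputable fun F a => decide (Φ F a < Ψ F a) :=
  map₂ (f := fun a b : ℕ => decide (a < b)) Primrec.nat_lt.decide.to_comp hΦ hΨ

theorem and {p q : (ℕ → ℕ) → α → Prop} [∀ F a, Decidable (p F a)] [∀ F a, Decidable (q F a)]
    (hp : ImplicitlyComputable fun F a => decide (p F a))
    (hq : ImplicitlyComputable fun F a => decide (q F a)) :
    ImplicitlyComputable fun F a => decide (p F a ∧ q F a) := by
  simpa only [Bool.decide_and] using map₂ (f := fun a b : Bool => a && b) Primrec.and.to_comp hp hq

theorem const (b : β) : ImplicitlyComputable fun (_ : ℕ → ℕ) (_ : α) => b :=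
  of_computable (Computable.const b)

/-- A function that is the only solution of an implicitly computable system of conditions is
implicitly computable. -/
theorem of_unique {P : (ℕ → ℕ) → ℕ → Bool} (hP : ImplicitlyComputable P) {f₀ : ℕ → ℕ}
    (h₀ : ∀ y, P f₀ y = true) (huniq : ∀ f, (∀ y, P f y = true) → f = f₀) :
    ImplicitlyComputable fun _ : ℕ → ℕ => f₀ := by
  obtain ⟨K, hK, ⟨F, hF⟩, E, hE, h⟩ := hP
  -- The new class consists of the joins of some `F ∈ K` with a solution `f`. Uniqueness forces `f =
  -- f₀`, so `f₀` can be read off the odd part.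
  refine ⟨evenPart ⁻¹' K ∩ {J | ∀ y, E J y = true},
    (hK.preimage oracleComputable_evenPart).inter ⟨E, hE, fun _ => Iff.rfl⟩,
    ⟨seqJoin F f₀, by simpa using hF, fun y => by rw [h F hF, h₀]⟩,
    fun J => oddPart (evenPart J), oracleComputable_oddPart.subst oracleComputable_evenPart, ?_⟩
  rintro J ⟨hJK, hJ⟩ f x
  have := huniq (oddPart J) fun y => by
    rw [← h _ hJK, seqJoin_evenPart_oddPart]; exact hJ y
  simp [this]

/-- A function defined by an implicitly computable recursion is implicitly computable. -/
theorem of_fixedPoint {T : (ℕ → ℕ) → ℕ → ℕ} (hT : ImplicitlyComputable T) {f₀ : ℕ → ℕ}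
    (h₀ : ∀ y, f₀ y = T f₀ y) (huniq : ∀ f, (∀ y, f y = T f y) → f = f₀) :
    ImplicitlyComputable fun _ : ℕ → ℕ => f₀ :=
  of_unique (oracle.eq hT) (fun y => by simpa using h₀ y)
    fun f hf => huniq f fun y => by simpa using hf y

end ImplicitlyComputable

/-! ### Unbounded search -/

/-- The least `k` with `h (x, k)`, increased by one, and `0` if there is none. -/
noncomputable def leastSucc (h : ℕ × ℕ → Bool) (x : ℕ) : ℕ :=
  open scoped Classical in if H : ∃ k, h (x, k) = true then Nat.find H + 1 else 0

theorem leastSucc_eq_zero {h : ℕ × ℕ → Bool} {x : ℕ} :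
    leastSucc h x = 0 ↔ ∀ k, h (x, k) = false := by
  unfold leastSucc
  split_ifs with H
  · obtain ⟨k, hk⟩ := H
    simp only [false_iff, not_forall]
    exact ⟨k, by simp [hk]⟩
  · simpa using H

theorem leastSucc_eq_succ {h : ℕ × ℕ → Bool} {x m : ℕ} :
    leastSucc h x = m + 1 ↔ h (x, m) = true ∧ ∀ k < m, h (x, k) = false := by
  classical
  unfold leastSucc
  split_ifs with H
  · simp [Nat.find_eq_iff]
  · simp only [false_iff]
    push Not at H
    simp [H]

/-- Both "no witness" and "`m` is the least witness" are universal statements over `j` once the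
claimed value is given. Hence the function is the unique solution of a system indexed by the pairs
`(x, j)`, although it need not be computable. -/
theorem ImplicitlyComputable.leastSucc {h : ℕ × ℕ → Bool}
    (hh : ImplicitlyComputable fun _ : ℕ → ℕ => h) :
    ImplicitlyComputable fun _ : ℕ → ℕ => leastSucc h := by
  have hx : Computable fun y : ℕ => y.unpair.1 := Computable.fst.comp Computable.unpair
  have hj : Computable fun y : ℕ => y.unpair.2 := Computable.snd.comp Computable.unpair
  have hf : ImplicitlyComputable fun (f : ℕ → ℕ) (y : ℕ) => f y.unpair.1 :=
    oracle.comp (of_computable hx)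
  have hp : ImplicitlyComputable fun (f : ℕ → ℕ) (y : ℕ) => (f y.unpair.1).pred :=
    map Computable.pred hf
  have h1 : ImplicitlyComputable fun (_ : ℕ → ℕ) (y : ℕ) => !h (y.unpair.1, y.unpair.2) :=
    map Primrec.not.to_comp (hh.comp ((of_computable hx).pair (of_computable hj)))
  have h2 : ImplicitlyComputable fun (f : ℕ → ℕ) (y : ℕ) => h (y.unpair.1, (f y.unpair.1).pred) :=
    hh.comp ((of_computable hx).pair hp)
  have hP := ite (hf.eq (const 0)) h1 (ite ((of_computable hj).lt hp)
    (map₂ (f := fun a b : Bool => a && b) Primrec.and.to_comp h2 h1) h2)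
  have key : ∀ f : ℕ → ℕ, (∀ y : ℕ, (if f y.unpair.1 = 0 then !h (y.unpair.1, y.unpair.2) else
      if y.unpair.2 < (f y.unpair.1).pred then
        h (y.unpair.1, (f y.unpair.1).pred) && !h (y.unpair.1, y.unpair.2)
      else h (y.unpair.1, (f y.unpair.1).pred)) = true) ↔ f = _root_.leastSucc h := by
    intro f
    rw [funext_iff]
    constructor
    · intro H x
      have H' := fun j => H (Nat.pair x j)
      simp only [Nat.unpair_pair] at H'
      rcases hfx : f x with _ | m
      · rw [eq_comm, leastSucc_eq_zero]
        simpa [hfx] using H'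
      · rw [eq_comm, leastSucc_eq_succ]
        simp only [hfx, Nat.pred_succ] at H'
        refine ⟨by simpa using H' m, fun k hk => ?_⟩
        have := H' k
        simp [hk] at this
        exact this.2
    · intro H y
      rcases hfx : f y.unpair.1 with _ | m
      · have := H y.unpair.1
        rw [hfx, eq_comm, leastSucc_eq_zero] at this
        simp [this]
      · have := H y.unpair.1
        rw [hfx, eq_comm, leastSucc_eq_succ] at this
        by_cases hlt : y.unpair.2 < m
        · simp [hlt, this.1, this.2]
        · simp [hlt, this.1]
  exact of_unique hP ((key _).2 rfl) fun f hf => (key f).1 hf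

/-! ### Closure of `E¹ₙ` under implicitly computable preimages -/

/-- The parity condition says that the innermost function quantifier is universal. Removing the
outermost quantifier flips both `b` and the parity, so it persists through the induction. -/
theorem altQuant_congr_of_last {m : ℕ} {b : Bool} (hb : b = true ↔ Odd (m + 1))
    {P P' : (Fin (m + 1) → ℕ → ℕ) → ℕ → Prop}
    (h : ∀ F : Fin m → ℕ → ℕ, (∀ f, ∃ y, P (Fin.snoc (α := fun _ => ℕ → ℕ) F f) y) ↔
      ∀ f, ∃ y, P' (Fin.snoc (α := fun _ => ℕ → ℕ) F f) y) :
    altQuant b (m + 1) P ↔ altQuant b (m + 1) P' := by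
  induction m generalizing b with
  | zero =>
    obtain rfl : b = true := hb.2 (by decide)
    have := h Fin.elim0
    simp only [altQuant]
    have hsnoc : ∀ f : ℕ → ℕ, Fin.cons (α := fun _ => ℕ → ℕ) f Fin.elim0 =
        Fin.snoc (α := fun _ => ℕ → ℕ) (Fin.elim0 : Fin 0 → ℕ → ℕ) f := fun f => by
      funext i
      obtain rfl : i = Fin.last 0 := Fin.ext (by omega)
      rw [Fin.snoc_last]
      rfl
    simpa only [hsnoc] using this
  | succ m ih =>
    have key : ∀ f, altQuant (!b) (m + 1) (fun F => P (Fin.cons f F)) ↔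
        altQuant (!b) (m + 1) (fun F => P' (Fin.cons f F)) := fun f => by
      apply ih
      · rw [Nat.odd_add_one] at hb
        cases b <;> simp_all
      · intro F
        have := h (Fin.cons f F)
        simpa only [Fin.cons_snoc_eq_snoc_cons] using this
    cases b
    · exact exists_congr key
    · exact forall_congr' key

/-- The last component of a join of `m + 1` functions. -/
def lastPart (m : ℕ) (J : ℕ → ℕ) (z : ℕ) : ℕ := J ((m + 1) * z + m)

/-- The join of `m + 1` functions with the last component replaced by its odd part. -/
def oddLastPart (m : ℕ) (J : ℕ → ℕ) (k : ℕ) : ℕ :=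
  if k % (m + 1) = m then oddPart (lastPart m J) (k / (m + 1)) else J k

theorem lastPart_oracleJoin {m : ℕ} (F : Fin (m + 1) → ℕ → ℕ) :
    lastPart m (oracleJoin F) = F (Fin.last m) := by
  funext z
  have h1 : ((m + 1) * z + m) % (m + 1) = m := by
    rw [Nat.mul_add_mod, Nat.mod_eq_of_lt (Nat.lt_succ_self m)]
  have h2 : ((m + 1) * z + m) / (m + 1) = z := by
    rw [Nat.mul_add_div (Nat.succ_pos m), Nat.div_eq_of_lt (Nat.lt_succ_self m), add_zero]
  simp [lastPart, oracleJoin, h1, h2, Fin.last]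

theorem oddLastPart_oracleJoin_snoc {m : ℕ} (F : Fin m → ℕ → ℕ) (f : ℕ → ℕ) :
    oddLastPart m (oracleJoin (Fin.snoc (α := fun _ => ℕ → ℕ) F f)) =
      oracleJoin (Fin.snoc (α := fun _ => ℕ → ℕ) F (oddPart f)) := by
  funext k
  have hk : k % (m + 1) < m + 1 := Nat.mod_lt _ (Nat.succ_pos m)
  unfold oddLastPart
  rw [lastPart_oracleJoin, Fin.snoc_last]
  simp only [oracleJoin, hk, dif_pos]
  split_ifs with h
  · have : (⟨k % (m + 1), hk⟩ : Fin (m + 1)) = Fin.last m := Fin.ext h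
    rw [this, Fin.snoc_last]
  · have : (⟨k % (m + 1), hk⟩ : Fin (m + 1)) = Fin.castSucc ⟨k % (m + 1), by omega⟩ := rfl
    rw [this, Fin.snoc_castSucc, Fin.snoc_castSucc]

theorem oracleComputable_lastPart (m : ℕ) : OracleComputable (lastPart m) :=
  OracleComputable.query (Primrec.nat_add.comp
    (Primrec.nat_mul.comp (Primrec.const (m + 1)) Primrec.id) (Primrec.const m)).to_comp

theorem OracleComputable.ite {α β : Type*} [Primcodable α] [Primcodable β]
    {b : (ℕ → ℕ) → α → Bool} {Φ Ψ : (ℕ → ℕ) → α → β} (hb : OracleComputable b)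
    (hΦ : OracleComputable Φ) (hΨ : OracleComputable Ψ) :
    OracleComputable fun F a => if b F a = true then Φ F a else Ψ F a := by
  have h : Computable fun t : Bool × β × β => cond t.1 t.2.1 t.2.2 :=
    Computable.cond Computable.fst (Computable.fst.comp Computable.snd)
      (Computable.snd.comp Computable.snd)
  have := map h (hb.pair (hΦ.pair hΨ))
  simpa [Bool.cond_eq_ite] using this

theorem oracleComputable_oddLastPart (m : ℕ) : OracleComputable (oddLastPart m) := by
  have hp : Computable fun k : ℕ => decide (k % (m + 1) = m) :=
    (Primrec.eq.comp (Primrec.nat_mod.comp Primrec.id (Primrec.const (m + 1)))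
      (Primrec.const m)).decide.to_comp
  have hd : Computable fun k : ℕ => k / (m + 1) :=
    (Primrec.nat_div.comp Primrec.id (Primrec.const (m + 1))).to_comp
  have := (OracleComputable.of_computable hp).ite
    ((oracleComputable_oddPart.subst (oracleComputable_lastPart m)).comp
      (OracleComputable.of_computable hd)) OracleComputable.oracle
  simp only [decide_eq_true_eq] at this
  exact this

theorem isRecursivePred_iff {m : ℕ} {R : ℕ → ℕ → (Fin (m + 1) → ℕ → ℕ) → Prop} :
    IsRecursivePred R ↔ ∃ Φ : (ℕ → ℕ) → ℕ → ℕ, OracleComputable Φ ∧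
      ∀ x y f, R x y f ↔ Φ (oracleJoin f) (Nat.pair x y) = 1 := by
  constructor
  · rintro ⟨c, hc⟩
    have hdom : ∀ J z, (c.eval J z).Dom := fun J z => by
      -- As there is at least one component, every oracle is a join; hence the program halts for all
      -- oracles.
      have hJ : J = oracleJoin fun (i : Fin (m + 1)) z => J ((m + 1) * z + i) := by
        funext k
        have hk : k % (m + 1) < m + 1 := Nat.mod_lt _ (Nat.succ_pos m)
        simp only [oracleJoin, hk, dif_pos, Nat.div_add_mod]
      rw [hJ, ← Nat.pair_unpair z]
      exact (hc _ _ _).1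
    refine ⟨fun J z => (c.eval J z).get (hdom J z), ⟨c, fun J z => ?_⟩, fun x y f => ?_⟩
    · simp
    · rw [(hc f x y).2]
      rw [← Part.get_eq_iff_mem]
  · rintro ⟨Φ, ⟨c, hc⟩, h⟩
    refine ⟨c, fun f x y => ?_⟩
    have := hc (oracleJoin f) (Nat.pair x y)
    simp only [encode_nat] at this
    rw [this, h]
    exact ⟨trivial, by simp [eq_comm]⟩

/-- The classes given by `altQuant` whose last function quantifier is universal are closed under
preimages by implicitly computable functions. -/
theorem exists_altQuant_preimage {m : ℕ} {b : Bool} (hb : b = true ↔ Odd (m + 1)) {X : Set ℕ}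
    (hX : ∃ R : ℕ → ℕ → (Fin (m + 1) → ℕ → ℕ) → Prop, IsRecursivePred R ∧
      ∀ x, x ∈ X ↔ altQuant b (m + 1) fun f y => R x y f)
    {h : ℕ → ℕ} (hh : ImplicitlyComputable fun _ : ℕ → ℕ => h) :
    ∃ R : ℕ → ℕ → (Fin (m + 1) → ℕ → ℕ) → Prop, IsRecursivePred R ∧
      ∀ x, x ∈ h ⁻¹' X ↔ altQuant b (m + 1) fun f y => R x y f := by
  obtain ⟨R, hR, hXR⟩ := hX
  obtain ⟨Φ, hΦ, hRΦ⟩ := isRecursivePred_iff.1 hR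
  obtain ⟨K, ⟨Q, hQ, hQK⟩, ⟨F₀, hF₀⟩, E, hE, hEh⟩ := hh
  have hx : Computable fun z : ℕ => z.unpair.1 := Computable.fst.comp Computable.unpair
  have hy : Computable fun z : ℕ => z.unpair.2 := Computable.snd.comp Computable.unpair
  have hq := (hQ.subst (oracleComputable_evenPart.subst (oracleComputable_lastPart m))).comp
    (OracleComputable.of_computable hy)
  have hpair := OracleComputable.map (Primrec₂.natPair.to_comp : Computable₂ Nat.pair)
    (((hE.subst (oracleComputable_lastPart m)).comp (OracleComputable.of_computable hx)).pair
      (OracleComputable.of_computable hy))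
  -- The last function carries the guess in its even part and the original argument in its odd part.
  -- The output `1` when the test fails makes the existential number quantifier true, so wrong
  -- guesses do no harm.
  have hΨ := hq.ite ((hΦ.subst (oracleComputable_oddLastPart m)).comp hpair)
    (OracleComputable.of_computable (Computable.const 1))
  refine ⟨fun x y f => _, isRecursivePred_iff.2 ⟨_, hΨ, fun x y f => Iff.rfl⟩, fun x => ?_⟩
  rw [Set.mem_preimage, hXR]
  refine altQuant_congr_of_last hb fun F => ?_
  simp only [hRΦ, lastPart_oracleJoin, oddLastPart_oracleJoin_snoc, Fin.snoc_last, Nat.unpair_pair]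
  constructor
  · intro H f
    by_cases hf : evenPart f ∈ K
    · obtain ⟨y, hy⟩ := H (oddPart f)
      have hfx : E f x = h x := by
        have := hEh _ hf (oddPart f) x
        rwa [seqJoin_evenPart_oddPart] at this
      exact ⟨y, by rw [hfx, hy]; simp⟩
    · rw [hQK] at hf
      push Not at hf
      obtain ⟨y, hy⟩ := hf
      exact ⟨y, by simp [hy]⟩
  · intro H f
    -- Nonemptiness of `K` enters here: a correct guess is available.
    obtain ⟨y, hy⟩ := H (seqJoin F₀ f)
    refine ⟨y, ?_⟩
    simpa [(hQK F₀).1 hF₀ y, hEh F₀ hF₀] using hy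

/-- The class `E¹ₙ` is closed under preimages by implicitly computable functions. -/
theorem IsE1.preimage {n : ℕ} (hn : n ≠ 0) {X : Set ℕ} (hX : IsE1 n X) {h : ℕ → ℕ}
    (hh : ImplicitlyComputable fun _ : ℕ → ℕ => h) : IsE1 n (h ⁻¹' X) := by
  obtain ⟨m, rfl⟩ := Nat.exists_eq_succ_of_ne_zero hn
  exact ⟨fun hodd => exists_altQuant_preimage (by simpa using hodd) (hX.1 hodd) hh,
    fun heven => exists_altQuant_preimage (by simpa using heven) (hX.2 heven) hh⟩

theorem IsE1ComputableNumbering.comp {n : ℕ} (hn : n ≠ 0) {ν : ℕ → Set ℕ}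
    (hν : IsE1ComputableNumbering n ν) {g : ℕ → ℕ}
    (hg : ImplicitlyComputable fun _ : ℕ → ℕ => g) :
    IsE1ComputableNumbering n fun k => ν (g k) := by
  have h : ImplicitlyComputable fun (_ : ℕ → ℕ) (p : ℕ) => Nat.pair (g p.unpair.1) p.unpair.2 :=
    .map₂ Primrec₂.natPair.to_comp
      (hg.comp (.of_computable (Computable.fst.comp Computable.unpair)))
      (.of_computable (Computable.snd.comp Computable.unpair))
  have := IsE1.preimage hn hν h
  simpa [IsE1ComputableNumbering, numberingGraph, Set.preimage] using this

/-! ### A universal function and recursion along a rank -/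

/-- Search finds the least halting stage of a program or reports that there is none, in which case a
default value makes `U` total. -/
theorem exists_implicitlyComputable_universal :
    ∃ U : ℕ × ℕ → ℕ, (ImplicitlyComputable fun _ : ℕ → ℕ => U) ∧
      ∀ f : ℕ → ℕ, Computable f → ∃ e, ∀ k, U (e, k) = f k := by
  let run : ℕ × ℕ → Option ℕ := fun p =>
    Nat.Partrec.Code.evaln p.2 (Denumerable.ofNat Nat.Partrec.Code p.1.unpair.1) p.1.unpair.2
  have hx : Computable fun p : ℕ × ℕ => p.1.unpair := Computable.unpair.comp Computable.fst
  have hrun : Computable run :=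
    Nat.Partrec.Code.primrec_evaln.to_comp.comp
      ((Computable.snd.pair ((Computable.ofNat _).comp (Computable.fst.comp hx))).pair
        (Computable.snd.comp hx))
  let h : ℕ × ℕ → Bool := fun p => (run p).isSome
  have hh : ImplicitlyComputable fun _ : ℕ → ℕ => h :=
    .of_computable (Primrec.option_isSome.to_comp.comp hrun)
  refine ⟨fun p => (run (Nat.pair p.1 p.2, (leastSucc h (Nat.pair p.1 p.2)).pred)).getD 0, ?_, ?_⟩
  · have hp : ImplicitlyComputable fun (_ : ℕ → ℕ) (p : ℕ × ℕ) => Nat.pair p.1 p.2 :=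
      .of_computable Primrec₂.natPair.to_comp
    exact .map (f := fun o : Option ℕ => o.getD 0)
      (Primrec.option_getD.comp Primrec.id (Primrec.const 0)).to_comp
      (.map hrun (hp.pair (.map Computable.pred (hh.leastSucc.comp hp))))
  · intro f hf
    obtain ⟨c, hc⟩ := Nat.Partrec.Code.exists_code.1 (Partrec.nat_iff.1 hf)
    refine ⟨encode c, fun k => ?_⟩
    have hrun_eq : ∀ t, run (Nat.pair (encode c) k, t) = Nat.Partrec.Code.evaln t c k := by
      intro t; simp [run]
    rcases hl : leastSucc h (Nat.pair (encode c) k) with _ | t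
    · rw [leastSucc_eq_zero] at hl
      have : f k ∈ c.eval k := by rw [hc]; simp
      obtain ⟨t, ht⟩ := Nat.Partrec.Code.evaln_complete.1 this
      have := hl t
      rw [Option.mem_def] at ht
      simp [h, hrun_eq, ht] at this
    · have h1 := (leastSucc_eq_succ.1 hl).1
      simp only [h, hrun_eq] at h1
      obtain ⟨v, hv⟩ := Option.isSome_iff_exists.1 h1
      have := Nat.Partrec.Code.evaln_sound (Option.mem_def.2 hv)
      rw [hc] at this
      have hfk : v = f k := by simpa using this
      rw [← hfk]
      beta_reduce
      rw [hl, Nat.pred_succ, hrun_eq, hv, Option.getD_some]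

/-- Well-founded recursion gives a solution and induction on the rank its uniqueness. Uniqueness
alone is what implicit computability needs, so the recursion never has to be unwound by a program.
-/
theorem ImplicitlyComputable.exists_fixedPoint {T : (ℕ → ℕ) → ℕ → ℕ}
    (hT : ImplicitlyComputable T) (rank : ℕ → ℕ)
    (hrank : ∀ f f' z, (∀ z', rank z' < rank z → f z' = f' z') → T f z = T f' z) :
    ∃ f₀ : ℕ → ℕ, (ImplicitlyComputable fun _ : ℕ → ℕ => f₀) ∧ ∀ z, f₀ z = T f₀ z := by
  let W := (measure rank).wf
  -- The default `0` at points of no smaller rank is irrelevant by `hrank`.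
  let f₀ : ℕ → ℕ := W.fix fun z ih => T (fun z' => if h : rank z' < rank z then ih z' h else 0) z
  have h₀ : ∀ z, f₀ z = T f₀ z := fun z => by
    have : f₀ z = T (fun z' => if rank z' < rank z then f₀ z' else 0) z := W.fix_eq _ z
    rw [this]
    exact hrank _ _ _ fun z' hz' => if_pos hz'
  refine ⟨f₀, of_fixedPoint hT h₀ fun f hf => funext fun z => ?_, h₀⟩
  induction z using W.induction with
  | _ z ih => rw [hf, h₀]; exact hrank _ _ _ ih

/-! ### The generic sequence -/

/-- The column of `x` when `ℕ` is viewed as the plane. -/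
def col (x : ℕ) : ℕ := x.unpair.1

theorem computable_col : Computable col := Computable.fst.comp Computable.unpair

theorem computable_unpair_snd : Computable fun x : ℕ => x.unpair.2 :=
  Computable.snd.comp Computable.unpair

/-- Any two computable functions `p`, `q` and any two numbers `i`, `j` are assigned to an interval
of columns that starts at `s`, and on these columns `p m` and `q m` are recorded for some `m`,
unless all values of `p` are in columns before `s`. -/
theorem exists_schedule : ∃ I J X Y B : ℕ → ℕ,
    (ImplicitlyComputable fun _ : ℕ → ℕ => I) ∧ (ImplicitlyComputable fun _ : ℕ → ℕ => J) ∧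
    (ImplicitlyComputable fun _ : ℕ → ℕ => X) ∧ (ImplicitlyComputable fun _ : ℕ → ℕ => Y) ∧
    (ImplicitlyComputable fun _ : ℕ → ℕ => B) ∧ (∀ c, B c ≤ c) ∧
    ∀ p q : ℕ → ℕ, Computable p → Computable q → ∀ i j, ∃ s, (∀ m, col (p m) < s) ∨
      ∃ m, s ≤ col (p m) ∧ (s ≤ col (q m) ∨ ∀ m', col (p m') < s ∨ col (q m') < s) ∧
        ∀ c, c = col (p m) ∨ c = col (q m) → s ≤ c →
          I c = i ∧ J c = j ∧ X c = p m ∧ Y c = q m ∧ B c = s := by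
  obtain ⟨U, hU, hUf⟩ := exists_implicitlyComputable_universal
  let P : ℕ × ℕ → ℕ := fun t => U (t.1.unpair.1.unpair.1, t.2)
  let Q : ℕ × ℕ → ℕ := fun t => U (t.1.unpair.1.unpair.2, t.2)
  have hP : ImplicitlyComputable fun _ : ℕ → ℕ => P :=
    hU.comp (.of_computable ((computable_col.comp (computable_col.comp Computable.fst)).pair
      Computable.snd))
  have hQ : ImplicitlyComputable fun _ : ℕ → ℕ => Q :=
    hU.comp (.of_computable ((computable_unpair_snd.comp
      (computable_col.comp Computable.fst)).pair Computable.snd))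
  have h1 : ImplicitlyComputable fun (_ : ℕ → ℕ) (t : ℕ × ℕ) => (t.1.unpair.1, t.2) :=
    .of_computable ((computable_col.comp Computable.fst).pair Computable.snd)
  have h2 : ImplicitlyComputable fun (_ : ℕ → ℕ) (t : ℕ × ℕ) => t.1.unpair.2 :=
    .of_computable (computable_unpair_snd.comp Computable.fst)
  let half : ℕ × ℕ → Bool := fun t => decide (t.1.unpair.2 ≤ col (P (t.1.unpair.1, t.2)))
  let full : ℕ × ℕ → Bool := fun t => decide (t.1.unpair.2 ≤ col (P (t.1.unpair.1, t.2)) ∧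
    t.1.unpair.2 ≤ col (Q (t.1.unpair.1, t.2)))
  have hhalf : ImplicitlyComputable fun _ : ℕ → ℕ => half :=
    h2.le (.map computable_col (hP.comp h1))
  have hfull : ImplicitlyComputable fun _ : ℕ → ℕ => full :=
    hhalf.and (h2.le (.map computable_col (hQ.comp h1)))
  -- An argument with both values in columns from `s` on is preferred; failing that, one with only
  -- the value of `p` there.
  let wit : ℕ → ℕ := fun z =>
    if leastSucc full z = 0 then (leastSucc half z).pred else (leastSucc full z).pred
  have hwit : ImplicitlyComputable fun _ : ℕ → ℕ => wit :=
    .ite (hfull.leastSucc.eq (.const 0)) (.map Computable.pred hhalf.leastSucc)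
      (.map Computable.pred hfull.leastSucc)
  have wit_spec : ∀ e s, (∃ m, s ≤ col (P (e, m))) → s ≤ col (P (e, wit (Nat.pair e s))) ∧
      (s ≤ col (Q (e, wit (Nat.pair e s))) ∨
        ∀ m, col (P (e, m)) < s ∨ col (Q (e, m)) < s) := by
    rintro e s ⟨m, hm⟩
    simp only [wit]
    rcases hf : leastSucc full (Nat.pair e s) with _ | w
    · rw [leastSucc_eq_zero] at hf
      simp only [if_true]
      rcases hh : leastSucc half (Nat.pair e s) with _ | w
      · rw [leastSucc_eq_zero] at hh
        have := hh m
        simp [half, hm] at this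
      · rw [leastSucc_eq_succ] at hh
        refine ⟨by simpa [half] using hh.1, Or.inr fun m => ?_⟩
        have := hf m
        simp only [full, Nat.unpair_pair, decide_eq_false_iff_not] at this
        omega
    · rw [leastSucc_eq_succ] at hf
      have := hf.1
      simp only [full, Nat.unpair_pair, decide_eq_true_eq] at this
      simp [this]
  -- The next interval starts after both recorded values, so that each of them not before `s` lies
  -- in the present interval.
  let step : ℕ → ℕ := fun z => max z.unpair.2
    (max (col (P (z.unpair.1, wit z)) + 1) (col (Q (z.unpair.1, wit z)) + 1))
  have hcol : ImplicitlyComputable fun (_ : ℕ → ℕ) (z : ℕ) => z.unpair.1 :=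
    .of_computable computable_col
  have hsnd : ImplicitlyComputable fun (_ : ℕ → ℕ) (z : ℕ) => z.unpair.2 :=
    .of_computable computable_unpair_snd
  have hmax : Computable₂ fun a b : ℕ => max a b := Primrec.nat_max.to_comp
  have hcol1 : Computable fun x : ℕ => col x + 1 := Computable.succ.comp computable_col
  have hstep : ImplicitlyComputable fun _ : ℕ → ℕ => step :=
    .map₂ hmax hsnd (.map₂ hmax (.map (f := fun x => col x + 1) hcol1 (hP.comp (hcol.pair hwit)))
      (.map (f := fun x => col x + 1) hcol1 (hQ.comp (hcol.pair hwit))))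
  have hid : ImplicitlyComputable fun (_ : ℕ → ℕ) (y : ℕ) => y := .of_computable Computable.id
  have hpred : ImplicitlyComputable fun (_ : ℕ → ℕ) (y : ℕ) => y.pred :=
    .of_computable Computable.pred
  obtain ⟨S, hS, hSrec⟩ := ImplicitlyComputable.exists_fixedPoint
    (T := fun f y => if y = 0 then 0 else step (Nat.pair y.pred (f y.pred)))
    (.ite (hid.eq (.const 0)) (.const 0) (hstep.comp (.map₂ Primrec₂.natPair.to_comp hpred
      (ImplicitlyComputable.oracle.comp hpred)))) id fun f f' z hz => by
        rcases z with _ | z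
        · rfl
        · simp only [Nat.succ_ne_zero, if_false, Nat.pred_succ]
          rw [hz z (Nat.lt_succ_self z)]
  have S_zero : S 0 = 0 := by rw [hSrec]; rfl
  have S_succ : ∀ e, S (e + 1) = step (Nat.pair e (S e)) := fun e => by
    rw [hSrec]; simp
  have S_mono : Monotone S := monotone_nat_of_le_succ fun e => by
    rw [S_succ]; simp [step]
  -- The requirement whose interval contains `c`. If the search fails the stage is `0`, and `S 0 =
  -- 0` keeps the start of the interval at most `c`.
  let stage : ℕ → ℕ := fun c =>
    (leastSucc (fun t : ℕ × ℕ => decide (t.1 < S (t.2 + 1))) c).pred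
  have hstage : ImplicitlyComputable fun _ : ℕ → ℕ => stage :=
    .map Computable.pred (ImplicitlyComputable.leastSucc
      ((ImplicitlyComputable.of_computable Computable.fst).lt
        (hS.comp (.of_computable (Computable.succ.comp Computable.snd)))))
  have S_stage_le : ∀ c, S (stage c) ≤ c := fun c => by
    simp only [stage]
    rcases hl : leastSucc (fun t : ℕ × ℕ => decide (t.1 < S (t.2 + 1))) c with _ | e
    · simp [S_zero]
    · rw [leastSucc_eq_succ] at hl
      rcases e with _ | e
      · simp [S_zero]
      · simpa using hl.2 e (Nat.lt_succ_self e)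
  have stage_eq : ∀ e c, S e ≤ c → c < S (e + 1) → stage c = e := fun e c h h' => by
    simp only [stage]
    rw [(leastSucc_eq_succ (m := e)).2]
    · rfl
    · refine ⟨by simpa using h', fun k hk => ?_⟩
      simpa using (S_mono hk).trans h
  have hSst : ImplicitlyComputable fun (_ : ℕ → ℕ) c => S (stage c) := hS.comp hstage
  have hW : ImplicitlyComputable fun (_ : ℕ → ℕ) c => wit (Nat.pair (stage c) (S (stage c))) :=
    hwit.comp (.map₂ Primrec₂.natPair.to_comp hstage hSst)
  refine ⟨fun c => (stage c).unpair.2.unpair.1, fun c => (stage c).unpair.2.unpair.2,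
    fun c => P (stage c, wit (Nat.pair (stage c) (S (stage c)))),
    fun c => Q (stage c, wit (Nat.pair (stage c) (S (stage c)))), fun c => S (stage c),
    .map (f := fun e => e.unpair.2.unpair.1) (computable_col.comp computable_unpair_snd) hstage,
    .map (f := fun e => e.unpair.2.unpair.2)
      (computable_unpair_snd.comp computable_unpair_snd) hstage,
    hP.comp (hstage.pair hW), hQ.comp (hstage.pair hW), hSst, S_stage_le, ?_⟩
  intro p q hp hq i j
  obtain ⟨a, ha⟩ := hUf p hp
  obtain ⟨b, hb⟩ := hUf q hq
  set e := Nat.pair (Nat.pair a b) (Nat.pair i j) with he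
  have hPe : ∀ m, P (e, m) = p m := fun m => by simp [P, he, ha]
  have hQe : ∀ m, Q (e, m) = q m := fun m => by simp [Q, he, hb]
  refine ⟨S e, ?_⟩
  by_cases H : ∀ m, col (p m) < S e
  · exact Or.inl H
  · right
    push Not at H
    have hspec := wit_spec e (S e) (by simpa only [hPe] using H)
    simp only [hPe, hQe] at hspec
    refine ⟨_, hspec.1, hspec.2, fun c hc hsc => ?_⟩
    have hlt : c < S (e + 1) := by
      rw [S_succ]
      simp only [step, Nat.unpair_pair, hPe, hQe, lt_max_iff]
      rcases hc with rfl | rfl <;> simp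
    have hst := stage_eq e c hsc hlt
    simp only [hst]
    exact ⟨by simp [he], by simp [he], hPe _, hQe _, trivial⟩

/-- `0` is mapped to `1`, and everything else to `0`. -/
def bitFlip (v : ℕ) : ℕ := if v = 0 then 1 else 0

theorem computable_bitFlip : Computable bitFlip :=
  (Primrec.ite (Primrec.eq.comp Primrec.id (Primrec.const 0)) (Primrec.const 1)
    (Primrec.const 0)).to_comp

theorem bitFlip_le_one (v : ℕ) : bitFlip v ≤ 1 := by
  unfold bitFlip; split_ifs <;> omega

/-- All `g k` follow a common `base`, except at the at most two points per column that
`exists_schedule` records for a requirement on `p`, `q`, `i`, `j`. There `g i (p m)` becomes `0` and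
`g j (q m)` becomes `1`; if `q m` lies before the interval, its value is already fixed and `g i (p
m)` becomes its flip. Independently, column `c` of `base` flips `g 0` along every computable map
into earlier columns. All references go to earlier columns, so the column is the rank of the
recursion. -/
theorem exists_generic_sequence : ∃ (g : ℕ → ℕ → ℕ) (base : ℕ → ℕ),
    (∀ k, ImplicitlyComputable fun _ : ℕ → ℕ => g k) ∧
    (ImplicitlyComputable fun _ : ℕ → ℕ => base) ∧
    (∀ c a, a < 3 → base (Nat.pair c a) = c) ∧
    (∀ c (u : ℕ → ℕ), Computable u → (∀ a, col (u a) < c) →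
      ∀ N, ∃ a, N < a ∧ base (Nat.pair c a) = bitFlip (g 0 (u a))) ∧
    (∀ k x, g k x ≤ max (col x) 1) ∧
    (∀ c, ∃ x₀ x₁, ∀ k x, col x = c → x ≠ x₀ → x ≠ x₁ → g k x = base x) ∧
    ∀ p q : ℕ → ℕ, Computable p → Computable q → ∀ i j, i ≠ j →
      (∃ m, g i (p m) = 0 ∧ g j (q m) = 1) ∨ ∃ s, (∀ m, col (p m) < s ∨ col (q m) < s) ∧
        ((∃ m, g i (p m) = bitFlip (g j (q m))) ∨ ∀ m, col (p m) < s) := by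
  obtain ⟨U, hU, hUf⟩ := exists_implicitlyComputable_universal
  obtain ⟨I, J, X, Y, B, hI, hJ, hX, hY, hB, hBle, hreq⟩ := exists_schedule
  let V : ℕ → ℕ := fun x => U (x.unpair.2.unpair.1, x.unpair.2)
  have hV : ImplicitlyComputable fun _ : ℕ → ℕ => V :=
    hU.comp (.of_computable ((computable_col.comp computable_unpair_snd).pair
      computable_unpair_snd))
  -- Three places of the column carry its own number, one more than the possible exceptions.
  -- Elsewhere the first component of the second coordinate names the program to diagonalize
  -- against, so every program gets infinitely many places.
  let Base : (ℕ → ℕ) → ℕ → ℕ := fun f x => if x.unpair.2 < 3 then col x else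
    if col (V x) < col x then bitFlip (f (Nat.pair 0 (V x))) else 0
  have hcol : ImplicitlyComputable fun (_ : ℕ → ℕ) (z : ℕ) => col z :=
    .of_computable computable_col
  have hsnd : ImplicitlyComputable fun (_ : ℕ → ℕ) (z : ℕ) => z.unpair.2 :=
    .of_computable computable_unpair_snd
  have hc : ImplicitlyComputable fun (_ : ℕ → ℕ) (z : ℕ) => col z.unpair.2 :=
    .map computable_col hsnd
  have hBase : ImplicitlyComputable Base :=
    .ite (hsnd.lt (.const 3)) hcol (.ite ((ImplicitlyComputable.map computable_col hV).lt hcol)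
      (.map computable_bitFlip (ImplicitlyComputable.oracle.comp
        (.map₂ Primrec₂.natPair.to_comp (.const 0) hV))) (.const 0))
  have hBase_congr : ∀ f f' x, (∀ z', col z'.unpair.2 < col x → f z' = f' z') →
      Base f x = Base f' x := fun f f' x h => by
    simp only [Base]
    split_ifs with h1 h2
    · rfl
    · rw [h _ (by simpa using h2)]
    · rfl
  have hBase_le : ∀ f x, Base f x ≤ max (col x) 1 := fun f x => by
    simp only [Base]
    split_ifs
    · exact le_max_left _ _
    · exact (bitFlip_le_one _).trans (le_max_right _ _)
    · exact Nat.zero_le _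
  let T : (ℕ → ℕ) → ℕ → ℕ := fun f z =>
    if z.unpair.1 = I (col z.unpair.2) ∧ z.unpair.2 = X (col z.unpair.2) then
      if col (Y (col z.unpair.2)) < B (col z.unpair.2) then
        bitFlip (f (Nat.pair (J (col z.unpair.2)) (Y (col z.unpair.2))))
      else 0
    else if z.unpair.1 = J (col z.unpair.2) ∧ z.unpair.2 = Y (col z.unpair.2) then 1
    else Base f z.unpair.2
  have hT : ImplicitlyComputable T :=
    .ite ((hcol.eq (hI.comp hc)).and (hsnd.eq (hX.comp hc)))
      (.ite ((ImplicitlyComputable.map computable_col (hY.comp hc)).lt (hB.comp hc))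
        (.map computable_bitFlip (ImplicitlyComputable.oracle.comp
          (.map₂ Primrec₂.natPair.to_comp (hJ.comp hc) (hY.comp hc)))) (.const 0))
      (.ite ((hcol.eq (hJ.comp hc)).and (hsnd.eq (hY.comp hc))) (.const 1) (hBase.comp hsnd))
  obtain ⟨f₀, hf₀, hf₀T⟩ := hT.exists_fixedPoint (fun z => col z.unpair.2) fun f f' z h => by
    simp only [T]
    split_ifs with h1 h2
    · rw [h _ (by simpa using h2.trans_le (hBle _))]
    · rfl
    · rfl
    · exact hBase_congr _ _ _ h
  have hg : ∀ k x, f₀ (Nat.pair k x) = if k = I (col x) ∧ x = X (col x) then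
      if col (Y (col x)) < B (col x) then bitFlip (f₀ (Nat.pair (J (col x)) (Y (col x)))) else 0
      else if k = J (col x) ∧ x = Y (col x) then 1 else Base f₀ x := fun k x => by
    rw [hf₀T]; simp [T]
  refine ⟨fun k x => f₀ (Nat.pair k x), Base f₀, fun k => hf₀.comp
    (.of_computable (Primrec₂.natPair.to_comp.comp (Computable.const k) Computable.id)), ?_,
    ?_, ?_, ?_, ?_, ?_⟩
  · refine .ite (hsnd.lt (.const 3)) hcol (.ite ((ImplicitlyComputable.map computable_col hV).lt
      hcol) (.map computable_bitFlip (hf₀.comp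
        (.map₂ Primrec₂.natPair.to_comp (.const 0) hV))) (.const 0))
  · intro c a ha
    simp [Base, ha, col]
  · intro c u hu hlt N
    obtain ⟨e, he⟩ := hUf u hu
    have hle : N + 3 ≤ Nat.pair e (N + 3) := Nat.right_le_pair _ _
    have hVe : V (Nat.pair c (Nat.pair e (N + 3))) = u (Nat.pair e (N + 3)) := by
      simp [V, he]
    refine ⟨Nat.pair e (N + 3), by omega, ?_⟩
    have h3 : ¬ Nat.pair e (N + 3) < 3 := by omega
    have hcc : col (Nat.pair c (Nat.pair e (N + 3))) = c := by simp [col]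
    simp only [Base, hVe, hcc, hlt, Nat.unpair_pair, h3, if_true, if_false]
  · intro k x
    change f₀ (Nat.pair k x) ≤ _
    rw [hg]
    split_ifs
    · exact (bitFlip_le_one _).trans (le_max_right _ _)
    · exact Nat.zero_le _
    · exact le_max_right _ _
    · exact hBase_le _ _
  · rintro c
    refine ⟨X c, Y c, ?_⟩
    rintro k x rfl h h'
    change f₀ (Nat.pair k x) = _
    rw [hg]
    simp [h, h']
  · intro p q hp hq i j hij
    obtain ⟨s, hs⟩ := hreq p q hp hq i j
    rcases hs with hs | ⟨m, hm, hfull, hact⟩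
    · exact Or.inr ⟨s, fun m => Or.inl (hs m), Or.inr hs⟩
    · obtain ⟨hIc, hJc, hXc, hYc, hBc⟩ := hact _ (Or.inl rfl) hm
      by_cases hq' : s ≤ col (q m)
      · left
        refine ⟨m, ?_, ?_⟩
        · change f₀ (Nat.pair i (p m)) = 0
          rw [hg]
          simp [hIc, hXc, hYc, hBc, hq']
        · obtain ⟨hIc, hJc, hXc, hYc, hBc⟩ := hact _ (Or.inr rfl) hq'
          change f₀ (Nat.pair j (q m)) = 1
          rw [hg]
          -- Since `i ≠ j`, the demand for `0` does not override this `1`, even if `p m = q m`.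
          simp [hIc, hYc, hJc, hij.symm]
      · refine Or.inr ⟨s, hfull.resolve_left hq', Or.inl ⟨m, ?_⟩⟩
        change f₀ (Nat.pair i (p m)) = bitFlip (f₀ (Nat.pair j (q m)))
        rw [hg]
        simp only [hIc, hJc, hXc, hYc, hBc, not_le.1 hq', and_self, if_true]

/-! ### Finite modifications and families with finitely many members -/

theorem computable_of_eq_off_finset {f g : ℕ → ℕ} (hf : Computable f) (s : Finset ℕ)
    (h : ∀ a ∉ s, g a = f a) : Computable g := by
  induction s using Finset.induction_on generalizing g with
  | empty => exact hf.of_eq fun a => (h a (Finset.notMem_empty a)).symm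
  | insert x s _ ih =>
    have h1 : Computable (Function.update g x (f x)) := ih fun a ha => by
      rcases eq_or_ne a x with rfl | hax
      · simp
      · rw [Function.update_of_ne hax, h a (by simp [hax, ha])]
    have hx : Computable fun a : ℕ => decide (a = x) :=
      (Primrec.eq.comp Primrec.id (Primrec.const x)).decide.to_comp
    refine (Computable.cond hx (Computable.const (g x)) h1).of_eq fun a => ?_
    rcases eq_or_ne a x with rfl | hax
    · simp
    · simp [hax]

/-- Both numberings have range `S`, so the finitely many exceptional indices can be redirected by a
finite table. -/
theorem numberingReducible_of_eq_off_finset {θ α : ℕ → Set ℕ} {S : Set (Set ℕ)}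
    (hθ : IsNumbering θ S) (hα : IsNumbering α S) {f : ℕ → ℕ} (hf : Computable f) (s : Finset ℕ)
    (h : ∀ a ∉ s, θ a = α (f a)) : NumberingReducible θ α := by
  have hex : ∀ a, ∃ b, α b = θ a := fun a => by
    have : θ a ∈ Set.range α := by rw [hα, ← hθ]; exact Set.mem_range_self a
    exact this
  choose idx hidx using hex
  refine ⟨fun a => if a ∈ s then idx a else f a,
    computable_of_eq_off_finset hf s fun a ha => by simp [ha], fun a => ?_⟩
  by_cases ha : a ∈ s
  · simp [ha, hidx]
  · simp [ha, h]

theorem IsNumbering.exists_bound_of_finite {ν : ℕ → Set ℕ} {S : Set (Set ℕ)}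
    (hν : IsNumbering ν S) (hS : S.Finite) : ∃ N, ∀ A ∈ S, ∃ k ≤ N, ν k = A := by
  have hex : ∀ A : Set ℕ, ∃ k, A ∈ S → ν k = A := fun A => by
    by_cases hA : A ∈ S
    · obtain ⟨k, hk⟩ : A ∈ Set.range ν := hν.symm ▸ hA
      exact ⟨k, fun _ => hk⟩
    · exact ⟨0, fun h => absurd h hA⟩
  choose idx hidx using hex
  exact ⟨hS.toFinset.sup idx, fun A hA =>
    ⟨idx A, Finset.le_sup (hS.mem_toFinset.2 hA), hidx A hA⟩⟩

theorem isNumbering_comp {ν : ℕ → Set ℕ} {S : Set (Set ℕ)} (hν : IsNumbering ν S) {h : ℕ → ℕ}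
    (hsurj : ∀ A ∈ S, ∃ k, ν (h k) = A) : IsNumbering (fun k => ν (h k)) S := by
  apply Set.Subset.antisymm
  · rintro _ ⟨k, rfl⟩
    exact hν ▸ Set.mem_range_self (h k)
  · exact hsurj

/-- The numbering `ν ∘ h`, for an implicitly computable `h`. -/
def E1Com.comp {n : ℕ} (hn : n ≠ 0) {S : Set (Set ℕ)} (ν : E1Com n S) {h : ℕ → ℕ}
    (hh : ImplicitlyComputable fun _ : ℕ → ℕ => h) (hsurj : ∀ A ∈ S, ∃ k, ν.1 (h k) = A) :
    E1Com n S :=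
  ⟨fun k => ν.1 (h k), isNumbering_comp ν.2.1 hsurj, ν.2.2.comp hn hh⟩

theorem E1Com.val_mem {n : ℕ} {S : Set (Set ℕ)} (ν : E1Com n S) (k : ℕ) : ν.1 k ∈ S := by
  have h : Set.range ν.1 = S := ν.2.1
  exact h.subset (Set.mem_range_self k)

theorem E1Com.exists_index {n : ℕ} {S : Set (Set ℕ)} (ν : E1Com n S) {A : Set ℕ} (hA : A ∈ S) :
    ∃ k, ν.1 k = A := by
  have : A ∈ Set.range ν.1 := by rw [ν.2.1]; exact hA
  exact this

/-- The degree of a numbering. -/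
def E1Com.degree {n : ℕ} {S : Set (Set ℕ)} (ν : E1Com n S) : RogersSemilattice n S :=
  toAntisymmetrization (· ≤ ·) ν

theorem E1Com.degree_le_degree {n : ℕ} {S : Set (Set ℕ)} {ν μ : E1Com n S} :
    ν.degree ≤ μ.degree ↔ NumberingReducible ν.1 μ.1 :=
  Iff.rfl

theorem E1Com.exists_degree_eq {n : ℕ} {S : Set (Set ℕ)} (c : RogersSemilattice n S) :
    ∃ ν : E1Com n S, ν.degree = c :=
  Quotient.inductionOn c fun ν => ⟨ν, rfl⟩

theorem E1Com.exists_zero_ne_one {n : ℕ} (hn : n ≠ 0) {S : Set (Set ℕ)} (ν : E1Com n S)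
    (hS2 : S.Nontrivial) : ∃ μ : E1Com n S, μ.1 0 ≠ μ.1 1 := by
  obtain ⟨A, hA, B, hB, hAB⟩ := hS2
  obtain ⟨a, rfl⟩ := ν.exists_index hA
  obtain ⟨b, rfl⟩ := ν.exists_index hB
  have hh : Computable fun k : ℕ => if k = 0 then a else if k = 1 then b else k - 2 :=
    (Primrec.ite (Primrec.eq.comp Primrec.id (Primrec.const 0)) (Primrec.const a)
      (Primrec.ite (Primrec.eq.comp Primrec.id (Primrec.const 1)) (Primrec.const b)
        (Primrec.nat_sub.comp Primrec.id (Primrec.const 2)))).to_comp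
  refine ⟨ν.comp hn (.of_computable hh) fun A hA => ?_, by simpa [E1Com.comp] using hAB⟩
  obtain ⟨k, hk⟩ := ν.exists_index hA
  exact ⟨k + 2, by simpa using hk⟩

theorem E1Com.exists_eq_zero_of_finite {n : ℕ} (hn : n ≠ 0) {S : Set (Set ℕ)} (ν : E1Com n S)
    (hS2 : S.Nontrivial) (hS : S.Finite) : ∃ μ : E1Com n S, ∀ k, μ.1 k = μ.1 0 → k = 0 := by
  classical
  obtain ⟨A, hA, B, hB, hAB⟩ := hS2
  obtain ⟨a, rfl⟩ := ν.exists_index hA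
  obtain ⟨b, rfl⟩ := ν.exists_index hB
  obtain ⟨N, hN⟩ := ν.2.1.exists_bound_of_finite hS
  -- Index `0` is reserved for `ν a`. The shifted indices up to `N + 1` list the other members of
  -- `S`, and `b` fills every remaining place.
  let h : ℕ → ℕ := fun k => if k = 0 then a else
    if k ≤ N + 1 ∧ ν.1 (k - 1) ≠ ν.1 a then k - 1 else b
  have hh : Computable h :=
    computable_of_eq_off_finset (Computable.const b) (Finset.range (N + 2)) fun k hk => by
      rw [Finset.mem_range] at hk
      have h1 : k ≠ 0 := by omega
      have h2 : ¬ k ≤ N + 1 := by omega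
      simp [h, h1, h2]
  refine ⟨ν.comp hn (.of_computable hh) fun A hA => ?_, fun k hk => ?_⟩
  · by_cases hAa : A = ν.1 a
    · exact ⟨0, by simp [h, hAa]⟩
    · obtain ⟨k, hkN, rfl⟩ := hN A hA
      exact ⟨k + 1, by simp [h, hkN, hAa]⟩
  · by_contra hk0
    simp only [E1Com.comp, h, hk0, if_true, if_false] at hk
    split_ifs at hk with h1
    · exact h1.2 hk
    · exact hAB hk.symm

/-- A numbering that is constant off a finite set reduces to every numbering of `S` by a finite
table. -/
theorem E1Com.exists_least_of_finite {n : ℕ} (hn : n ≠ 0) {S : Set (Set ℕ)} (ν : E1Com n S)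
    (hS : S.Finite) : ∃ μ : E1Com n S, ∀ ξ : E1Com n S, NumberingReducible μ.1 ξ.1 := by
  obtain ⟨N, hN⟩ := ν.2.1.exists_bound_of_finite hS
  have hh : Computable fun k : ℕ => if k ≤ N then k else 0 :=
    (Primrec.ite (Primrec.nat_le.comp Primrec.id (Primrec.const N)) Primrec.id
      (Primrec.const 0)).to_comp
  refine ⟨ν.comp hn (.of_computable hh) fun A hA => ?_, fun ξ => ?_⟩
  · obtain ⟨k, hkN, hk⟩ := hN A hA
    exact ⟨k, by simpa [hkN] using hk⟩
  · obtain ⟨b, hb⟩ := ξ.exists_index (ν.val_mem 0)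
    refine numberingReducible_of_eq_off_finset (E1Com.comp _ _ _ _).2.1 ξ.2.1
      (Computable.const b) (Finset.range (N + 1)) fun a ha => ?_
    have : ¬ a ≤ N := by simpa using ha
    simp [E1Com.comp, this, hb]

/-- The infimum is the supremum of the common lower bounds, a finite set containing `b`. -/
theorem isLatticeSemilattice_of_finite {α : Type} [SemilatticeSup α] [Finite α] (b : α)
    (hb : ∀ a, b ≤ a) : IsLatticeSemilattice α := by
  classical
  intro x y
  have := Fintype.ofFinite α
  let s : Finset α := Finset.univ.filter fun c => c ≤ x ∧ c ≤ y
  have hs : s.Nonempty := ⟨b, by simp [s, hb]⟩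
  refine ⟨s.sup' hs id, ?_, fun c hc => ?_⟩
  · rintro z (rfl | rfl)
    · exact Finset.sup'_le _ _ fun c hc => by simp only [s, Finset.mem_filter] at hc; exact hc.2.1
    · exact Finset.sup'_le _ _ fun c hc => by simp only [s, Finset.mem_filter] at hc; exact hc.2.2
  · refine Finset.le_sup' (f := id) (b := c) ?_
    simp only [s, Finset.mem_filter, Finset.mem_univ, true_and]
    exact ⟨hc (by simp), hc (by simp)⟩

/-! ### Numberings from the generic sequence -/

/-- Of the three places in column `c` with base value `c`, at most two are exceptional. This makes
each `ν ∘ g k` a numbering of all of `S`. -/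
theorem exists_apply_eq_of_noise {g : ℕ → ℕ → ℕ} {base : ℕ → ℕ}
    (hbase : ∀ c a, a < 3 → base (Nat.pair c a) = c)
    (hnoise : ∀ c, ∃ x₀ x₁, ∀ k x, col x = c → x ≠ x₀ → x ≠ x₁ → g k x = base x) (k c : ℕ) :
    ∃ x, g k x = c := by
  obtain ⟨x₀, x₁, h⟩ := hnoise c
  have hx : ∃ a < 3, Nat.pair c a ≠ x₀ ∧ Nat.pair c a ≠ x₁ := by
    by_contra! H
    have h0 := H 0 (by norm_num)
    have h1 := H 1 (by norm_num)
    have h2 := H 2 (by norm_num)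
    have h01 : Nat.pair c 0 ≠ Nat.pair c 1 := by simp
    have h02 : Nat.pair c 0 ≠ Nat.pair c 2 := by simp
    have h12 : Nat.pair c 1 ≠ Nat.pair c 2 := by simp
    grind
  obtain ⟨a, ha, ha0, ha1⟩ := hx
  exact ⟨_, (h k _ (by simp [col]) ha0 ha1).trans (hbase c a ha)⟩

theorem exists_pairwise_no_lower_bound {n : ℕ} (hn : n ≠ 0) {S : Set (Set ℕ)} (ν₀ : E1Com n S)
    (hS2 : S.Nontrivial) (hS : S.Infinite) : ∃ α : ℕ → E1Com n S, ∀ i j, i ≠ j → ∀ ξ : E1Com n S,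
      ¬ (NumberingReducible ξ.1 (α i).1 ∧ NumberingReducible ξ.1 (α j).1) := by
  obtain ⟨ν, hν⟩ := ν₀.exists_zero_ne_one hn hS2
  obtain ⟨g, base, hg, -, hbase, -, hle, hnoise, hgen⟩ := exists_generic_sequence
  refine ⟨fun k => ν.comp hn (hg k) fun A hA => ?_, ?_⟩
  · obtain ⟨c, rfl⟩ := ν.exists_index hA
    obtain ⟨x, hx⟩ := exists_apply_eq_of_noise hbase hnoise k c
    exact ⟨x, by rw [hx]⟩
  · rintro i j hij ξ ⟨⟨p, hp, hξp⟩, q, hq, hξq⟩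
    simp only [E1Com.comp] at hξp hξq
    rcases hgen p q hp hq i j hij with ⟨m, h0, h1⟩ | ⟨s, hs, -⟩
    · refine hν ?_
      rw [← h0, ← h1, ← hξp, ← hξq]
    -- Values of `g k` in columns before `s` are at most `max s 1`, so `ν` of these finitely many
    -- numbers would exhaust `S`.
    · refine hS (((Set.finite_Iic (max s 1)).image ν.1).subset fun A hA => ?_)
      obtain ⟨m, rfl⟩ := ξ.exists_index hA
      rcases hs m with h | h
      · exact ⟨_, (hle i (p m)).trans (max_le_max_right 1 h.le), (hξp m).symm⟩
      · exact ⟨_, (hle j (q m)).trans (max_le_max_right 1 h.le), (hξq m).symm⟩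

theorem not_isLatticeSemilattice_of_finite {n : ℕ} (hn : n ≠ 0) {S : Set (Set ℕ)}
    (ν₀ : E1Com n S) (hS2 : S.Nontrivial) (hS : S.Finite) :
    ¬ IsLatticeSemilattice (RogersSemilattice n S) := by
  intro hlat
  obtain ⟨ν, hν⟩ := ν₀.exists_eq_zero_of_finite hn hS2 hS
  have hflip : ∀ v, ν.1 (bitFlip v) ≠ ν.1 v := fun v hv => by
    unfold bitFlip at hv
    split_ifs at hv with h
    · subst h
      exact one_ne_zero (hν 1 hv)
    · exact h (hν v hv.symm)
  obtain ⟨g, base, hg, hbaseIC, hbase, hdiag, -, hnoise, hgen⟩ := exists_generic_sequence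
  let α : ℕ → E1Com n S := fun k => ν.comp hn (hg k) fun A hA => by
    obtain ⟨c, rfl⟩ := ν.exists_index hA
    obtain ⟨x, hx⟩ := exists_apply_eq_of_noise hbase hnoise k c
    exact ⟨x, by rw [hx]⟩
  have hα : ∀ k x, (α k).1 x = ν.1 (g k x) := fun k x => rfl
  obtain ⟨c, hc⟩ := hlat (α 0).degree (α 1).degree
  obtain ⟨ξ, rfl⟩ := E1Com.exists_degree_eq c
  obtain ⟨p, hp, hξp⟩ := E1Com.degree_le_degree.1 (hc.1 (Set.mem_insert _ _))
  obtain ⟨q, hq, hξq⟩ := E1Com.degree_le_degree.1 (hc.1 (Set.mem_insert_of_mem _ rfl))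
  have hpq : ∀ m, ν.1 (g 0 (p m)) = ν.1 (g 1 (q m)) := fun m => by
    rw [← hα, ← hα, ← hξp, ← hξq]
  rcases hgen p q hp hq 0 1 zero_ne_one with ⟨m, h0, h1⟩ | ⟨s, -, ⟨m, hm⟩ | hs⟩
  · have := hpq m
    rw [h0, h1] at this
    exact one_ne_zero (hν 1 this.symm)
  · have := hpq m
    rw [hm] at this
    exact hflip _ this
  · obtain ⟨N, hN⟩ := ν.2.1.exists_bound_of_finite hS
    -- The indices up to `N` only ensure that all of `S` is numbered; the rest is column `s` of
    -- `base`, on which `α 0` and `α 1` agree up to two exceptions.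
    have hθIC : ImplicitlyComputable fun (_ : ℕ → ℕ) (a : ℕ) =>
        if a ≤ N then a else base (Nat.pair s a) :=
      .ite ((ImplicitlyComputable.of_computable Computable.id).le (.const N))
        (.of_computable Computable.id) (hbaseIC.comp (.of_computable
          (Primrec₂.natPair.to_comp.comp (Computable.const s) Computable.id)))
    let θ : E1Com n S := ν.comp hn hθIC fun A hA => by
      obtain ⟨k, hkN, hk⟩ := hN A hA
      exact ⟨k, by simpa [hkN] using hk⟩
    have hθ : ∀ a, N < a → θ.1 a = ν.1 (base (Nat.pair s a)) := fun a ha => by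
      simp [θ, E1Com.comp, not_le.2 ha]
    obtain ⟨x₀, x₁, hx⟩ := hnoise s
    have hθα : ∀ k, θ.degree ≤ (α k).degree := fun k =>
      numberingReducible_of_eq_off_finset (f := fun a => Nat.pair s a) θ.2.1 (α k).2.1
        (Primrec₂.natPair.to_comp.comp (Computable.const s) Computable.id)
        (Finset.range (N + 1) ∪ {x₀.unpair.2, x₁.unpair.2}) fun a ha => by
          simp only [Finset.mem_union, Finset.mem_range, Finset.mem_insert,
            Finset.mem_singleton, not_or] at ha
          rw [hθ a (by omega), hα, hx k (Nat.pair s a) (by simp [col])]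
          · rintro rfl; simp at ha
          · rintro rfl; simp at ha
    have hθξ : θ.degree ≤ ξ.degree := hc.2 (by
      rintro z (rfl | rfl)
      · exact hθα 0
      · exact hθα 1)
    obtain ⟨r, hr, hθr⟩ := E1Com.degree_le_degree.1 hθξ
    -- The computable map `p ∘ r` reduces `θ` to `α 0` inside the columns before `s`, against which
    -- column `s` diagonalizes. The place is taken beyond `N`, where `θ` follows `base`.
    obtain ⟨a, haN, ha⟩ := hdiag s (fun a => p (r a)) (hp.comp hr) (fun a => hs _) N
    refine hflip (g 0 (p (r a))) ?_
    rw [← ha, ← hθ a haN, hθr, hξp, hα]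

theorem mainTheorem7 (n : ℕ) (hn : n ≠ 0) (S : Set (Set ℕ))
    (hS : IsE1ComputableFamily n S) (hS2 : S.Nontrivial) :
    Infinite (RogersSemilattice n S) ∧ ¬ IsLatticeSemilattice (RogersSemilattice n S) := by
  obtain ⟨ν, hν, hνc⟩ := hS
  let ν₀ : E1Com n S := ⟨ν, hν, hνc⟩
  rcases S.finite_or_infinite with hfin | hinf
  · have hlat := not_isLatticeSemilattice_of_finite hn ν₀ hS2 hfin
    refine ⟨not_finite_iff_infinite.1 fun hR => hlat ?_, hlat⟩
    obtain ⟨μ, hμ⟩ := ν₀.exists_least_of_finite hn hfin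
    refine isLatticeSemilattice_of_finite μ.degree fun a => ?_
    obtain ⟨ξ, rfl⟩ := E1Com.exists_degree_eq a
    exact hμ ξ
  · obtain ⟨α, hα⟩ := exists_pairwise_no_lower_bound hn ν₀ hS2 hinf
    constructor
    · refine Infinite.of_injective (fun k => (α k).degree) fun i j hij => ?_
      by_contra hne
      exact hα i j hne (α i) ⟨E1Com.degree_le_degree.1 le_rfl, E1Com.degree_le_degree.1 hij.le⟩
    · intro hlat
      obtain ⟨c, hc⟩ := hlat (α 0).degree (α 1).degree
      obtain ⟨ξ, rfl⟩ := E1Com.exists_degree_eq c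
      exact hα 0 1 zero_ne_one ξ ⟨hc.1 (Set.mem_insert _ _),
        hc.1 (Set.mem_insert_of_mem _ rfl)⟩
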